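/- All graphs are finite, simple and undirected. A plane graph is a connected planar graph together with an embedding in the plane; the size of a face is the length of its boundary walk. A type-two Barnette graph is a cubic plane graph all of whose faces (including the unbounded one) have size $3$, $4$, $5$ or $6$. A graph is distance-two four-colorable if its vertices can be colored with four colors so that, for every vertex $v$, the colors of $v$ and of all its neighbors are pairwise distinct. For $k\ge 0$ the Goodey graph $C_k$ is obtained from the cube with vertex set $\{0,1\}^3$ by replacing each vertex by a triangular patch. Explicitly, the vertices of $C_k$ are the pairs $(\varepsilon,t)$ with $\varepsilon\in\{0,1\}^3$, $t\in\mathbb{Z}_{\ge 0}^3$ and $t_1+t_2+t_3\in\{k,k-1\}$; the edges join $(\varepsilon,t)$ to $(\varepsilon,t+e_i)$ whenever $t_1+t_2+t_3=k-1$ and $i\in\{1,2,3\}$, where $e_i$ is the $i$-th unit vector, and $(\varepsilon,t)$ to $(\varepsilon',t)$ whenever $t_1+t_2+t_3=k$, $t_i=0$, and $\varepsilon,\varepsilon'$ differ exactly in the $i$-th coordinate. Thus $C_0$ is the cube, and $C_k$ has $8(k+1)^2$ vertices and, in its plane embedding, six faces of size $4$ and all other faces of size $6$. **Theorem.** Let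 $G$ be a type-two Barnette graph. Then $G$ is distance-two four-colorable if and only if $G$ is isomorphic to one of the graphs $C_k$, $k\ge 0$, or all faces of $G$ have size $3$ or $6$. Moreover, the distance-two four-coloring problem for type-two Barnette graphs is solvable in polynomial time: there is an algorithm (a program for a random access machine with unit-cost addition and subtraction) which, given a type-two Barnette graph on the vertices $0,\dots,n-1$ by the list of the three neighbors of each vertex in the cyclic order of the embedding, decides whether it is distance-two four-colorable in a number of steps bounded by a polynomial in $n$. -/

import Mathlib

namespace BarnetteColoring

universe u

/-! ### Plane graphs

A plane graph is given combinatorially, by its rotation system: the cyclic order of the edges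
around every vertex. Faces are the orbits of the face-tracing permutation, and the embedding is in
the sphere (equivalently, in the plane) exactly when Euler's formula holds. -/

/-- A rotation system on `G`: a permutation of the darts (directed edges) of `G` whose cycles are
exactly the sets of darts leaving a common vertex. -/
structure RotationSystem {V : Type u} (G : SimpleGraph V) where
  /-- the next dart around the initial vertex -/
  rot : Equiv.Perm G.Dart
  rot_fst : ∀ d, (rot d).fst = d.fst
  sameCycle : ∀ d e : G.Dart, d.fst = e.fst → rot.SameCycle d e

namespace RotationSystem

variable {V : Type u} {G : SimpleGraph V} (R : RotationSystem G)

/-- Face tracing: after traversing the dart `d = (u, v)`, continue with the dart that follows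
`(v, u)` in the rotation at `v`. -/
def facePerm : Equiv.Perm G.Dart :=
  (SimpleGraph.Dart.symm_involutive (G := G)).toPerm.trans R.rot

/-- The faces: orbits of darts under face tracing. -/
def Face : Type u := Quotient (Equiv.Perm.SameCycle.setoid R.facePerm)

/-- The face that a dart bounds. -/
def faceOf (d : G.Dart) : R.Face := Quotient.mk (Equiv.Perm.SameCycle.setoid R.facePerm) d

/-- The size of a face is the length of its boundary walk (an edge with the face on both of its
sides counts twice). -/
noncomputable def faceSize (f : R.Face) : ℕ := {d : G.Dart | R.faceOf d = f}.ncard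

/-- The rotation system describes a plane embedding of the connected graph `G`:
`#V - #E + #F = 2`. -/
def IsPlane : Prop :=
  G.Connected ∧ (Nat.card V : ℤ) - (G.edgeSet.ncard : ℤ) + (Nat.card R.Face : ℤ) = 2

/-- A type-two Barnette graph: a cubic plane graph all of whose faces have size 3, 4, 5 or 6. -/
def IsTypeTwoBarnette : Prop :=
  R.IsPlane ∧ (∀ v, (G.neighborSet v).ncard = 3) ∧
    ∀ f : R.Face, R.faceSize f = 3 ∨ R.faceSize f = 4 ∨ R.faceSize f = 5 ∨ R.faceSize f = 6

end RotationSystem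

/-! ### Distance-two colorings -/

/-- `G` has a distance-two `r`-coloring: an assignment of `r` colors to the vertices such that, for
every vertex `v`, the colors of `v` and of all its neighbors are all distinct. -/
def DistanceTwoColorable {V : Type u} (G : SimpleGraph V) (r : ℕ) : Prop :=
  ∃ c : V → Fin r, ∀ v, Set.InjOn c (insert v (G.neighborSet v))

/-! ### The Goodey graphs `C_k` -/

/-- The vertices of the `k`-th Goodey graph. Every vertex `ε ∈ {0,1}³` of the cube is replaced by a
triangular patch. Its vertices are the `(k+1)²` small triangles into which a big triangle of side
length `k+1` is cut, in barycentric coordinates: an upward triangle is a triple `t` of sum `k`, a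
downward triangle is a triple `t` of sum `k-1`. -/
def GoodeyVertex (k : ℕ) : Type :=
  (Fin 3 → Bool) × {t : Fin 3 → ℕ // t 0 + t 1 + t 2 = k ∨ t 0 + t 1 + t 2 + 1 = k}

/-- Two small triangles of the same patch share a side: the downward triangle `s` and the upward
triangle `t = s + eᵢ` for some `i`. -/
def GoodeyInner {k : ℕ} (x y : GoodeyVertex k) : Prop :=
  x.1 = y.1 ∧ ∃ i, y.2.1 = x.2.1 + Pi.single i 1

/-- Two small triangles meet across the common side of two patches: for a direction `i`, the
patches belong to the ends of an edge of the cube of direction `i`, and both triangles are the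
upward triangle `t`, which lies on the `i`-th side (`tᵢ = 0`) of its patch. -/
def GoodeyOuter {k : ℕ} (x y : GoodeyVertex k) : Prop :=
  x.2 = y.2 ∧ x.2.1 0 + x.2.1 1 + x.2.1 2 = k ∧
    ∃ i, x.2.1 i = 0 ∧ ∀ j, x.1 j ≠ y.1 j ↔ j = i

/-- The Goodey graph `C_k`. For `k = 0` it is the cube; in general, there are `k` hexagons between
any two neighboring squares among the six squares, and `k(k-1)/2` hexagons in the middle of each of
the eight patches. -/
def goodeyGraph (k : ℕ) : SimpleGraph (GoodeyVertex k) where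
  Adj x y := GoodeyInner x y ∨ GoodeyInner y x ∨ GoodeyOuter x y
  symm := by
    refine ⟨?_⟩
    rintro x y (h | h | ⟨h₁, h₂, i, h₃, h₄⟩)
    · exact Or.inr (Or.inl h)
    · exact Or.inl h
    · refine Or.inr (Or.inr ⟨h₁.symm, h₁ ▸ h₂, i, h₁ ▸ h₃, fun j => ?_⟩)
      rw [ne_comm]
      exact h₄ j
  loopless := by
    refine ⟨?_⟩
    have key : ∀ x : GoodeyVertex k, ¬ GoodeyInner x x := by
      rintro x ⟨-, i, hi⟩
      have := congrFun hi i
      simp at this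
    rintro x (h | h | ⟨-, -, i, -, h⟩)
    · exact key x h
    · exact key x h
    · exact (h i).2 rfl rfl

/-! ### Polynomial time

A random access machine with unit-cost addition and subtraction (no multiplication), programmed in
structured form. There are numbered registers and a memory whose cells are addressed indirectly
through the registers. A program mentions only finitely many registers. -/

/-- A state of the machine. -/
structure State where
  /-- contents of the registers -/
  reg : ℕ → ℕ
  /-- contents of the memory cells -/
  mem : ℕ → ℕ

/-- Programs. -/
inductive Cmd : Type
  /-- do nothing -/
  | skip
  /-- `reg r := n` -/
  | const (r n : ℕ)
  /-- `reg r := reg a + reg b` -/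
  | add (r a b : ℕ)
  /-- `reg r := reg a - reg b` (zero if negative) -/
  | sub (r a b : ℕ)
  /-- `reg r := mem (reg a)` -/
  | load (r a : ℕ)
  /-- `mem (reg a) := reg r` -/
  | store (a r : ℕ)
  /-- first `c`, then `c'` -/
  | seq (c c' : Cmd)
  /-- `if reg r ≠ 0 then c else c'` -/
  | ite (r : ℕ) (c c' : Cmd)
  /-- `while reg r ≠ 0 do c` -/
  | loop (r : ℕ) (c : Cmd)

/-- Put `n` into register `r`. -/
def State.setReg (s : State) (r n : ℕ) : State := ⟨Function.update s.reg r n, s.mem⟩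

/-- Put `n` into memory cell `a`. -/
def State.setMem (s : State) (a n : ℕ) : State := ⟨s.reg, Function.update s.mem a n⟩

/-- `Runs c s s' t`: started in state `s`, the program `c` halts in state `s'` after exactly `t`
steps. Every elementary instruction and every test of a register is one step. -/
inductive Runs : Cmd → State → State → ℕ → Prop
  | skip (s : State) : Runs .skip s s 1
  | const (s : State) (r n : ℕ) : Runs (.const r n) s (s.setReg r n) 1
  | add (s : State) (r a b : ℕ) : Runs (.add r a b) s (s.setReg r (s.reg a + s.reg b)) 1
  | sub (s : State) (r a b : ℕ) : Runs (.sub r a b) s (s.setReg r (s.reg a - s.reg b)) 1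
  | load (s : State) (r a : ℕ) : Runs (.load r a) s (s.setReg r (s.mem (s.reg a))) 1
  | store (s : State) (a r : ℕ) : Runs (.store a r) s (s.setMem (s.reg a) (s.reg r)) 1
  | seq {c c' : Cmd} {s s' s'' : State} {t t' : ℕ} :
      Runs c s s' t → Runs c' s' s'' t' → Runs (.seq c c') s s'' (t + t')
  | iteTrue {r : ℕ} {c c' : Cmd} {s s' : State} {t : ℕ} :
      s.reg r ≠ 0 → Runs c s s' t → Runs (.ite r c c') s s' (t + 1)
  | iteFalse {r : ℕ} {c c' : Cmd} {s s' : State} {t : ℕ} :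
      s.reg r = 0 → Runs c' s s' t → Runs (.ite r c c') s s' (t + 1)
  | loopDone {r : ℕ} {c : Cmd} {s : State} :
      s.reg r = 0 → Runs (.loop r c) s s 1
  | loopStep {r : ℕ} {c : Cmd} {s s' s'' : State} {t t' : ℕ} :
      s.reg r ≠ 0 → Runs c s s' t → Runs (.loop r c) s' s'' t' →
      Runs (.loop r c) s s'' (t + t' + 1)

/-- The initial state on the input `xs`: the input stands in the first memory cells, its length in
register `0`, and everything else is `0`. -/
def State.init (xs : List ℕ) : State :=
  ⟨fun r => if r = 0 then xs.length else 0, fun a => xs.getD a 0⟩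

/-- The decision problem with instances `x : ι`, presented to the machine as `enc x`, and question
`Q x`, is solvable in polynomial time: one program answers correctly in register `0` (`1` for yes,
`0` for no) on all instances, within a number of steps bounded by a polynomial in the length of the
input. -/
def SolvableInPolynomialTime {ι : Type} (enc : ι → List ℕ) (Q : ι → Prop) : Prop :=
  ∃ (c : Cmd) (p : Polynomial ℕ), ∀ x : ι, ∃ (s : State) (t : ℕ),
    Runs c (State.init (enc x)) s t ∧ t ≤ p.eval (enc x).length ∧
      (Q x → s.reg 0 = 1) ∧ (¬ Q x → s.reg 0 = 0)

/-- A type-two Barnette graph as an input to an algorithm: its vertices are `0, …, n-1`, and a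
table lists the three neighbors of every vertex in the cyclic order of the embedding. -/
structure BarnetteInstance where
  /-- number of vertices -/
  n : ℕ
  /-- the graph -/
  G : SimpleGraph (Fin n)
  /-- its embedding -/
  R : RotationSystem G
  isTypeTwoBarnette : R.IsTypeTwoBarnette
  /-- the table -/
  nbr : Fin n → Fin 3 → Fin n
  nbr_spec : ∀ v i, ∃ h : G.Adj v (nbr v i), (R.rot ⟨(v, nbr v i), h⟩).snd = nbr v (i + 1)

/-- The input: the `3n` entries of the table, row by row (all of them are smaller than `n`). -/
def BarnetteInstance.encode (I : BarnetteInstance) : List ℕ :=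
  List.ofFn fun j : Fin (I.n * 3) => (I.nbr j.divNat j.modNat : ℕ)

end BarnetteColoring

-- In a distance-two four-coloring a vertex and its three neighbors carry all four colors, so every
-- vertex sees them in one of two orientations, and every edge preserves or reverses the
-- orientation. Any three consecutive vertices of a face walk have distinct colors, and the middle
-- edge of v₀v₁v₂v₃ reverses exactly when v₀ and v₃ have different colors
-- (`mem_reversingDarts_facePerm`). Hence triangles have no reversing edge, all edges of a square
-- reverse, pentagons cannot occur, and a hexagon has no reversing edge or two opposite ones. The
-- reversing edges thus form straight lines through the hexagons, a `LineSystem`.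
--
-- Conversely, a line system prescribes for every dart a permutation of the four colors, and the
-- product around each face is trivial. On the sphere such an assignment is a coboundary
-- (`exists_potential`), which gives a coloring. Simple connectivity enters by counting: the
-- covering with group S belonging to the assignment has Euler characteristic at least 2|S|, while
-- `card_cycles_add_le` bounds it by twice the number of components, so the covering splits into
-- single sheets.
--
-- Without squares the faces have sizes 3 and 6, and the empty line system serves. If there is a
-- square, take two squares joined by a line of minimal length ℓ = k + 1. This line and the next one
-- leaving the same square span a triangle of the hexagonal lattice. Its faces other than the
-- corners are hexagons (`hex_of_row`): a square would send a line into the previous row, and a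
-- triangle would fold its row back so that a boundary line also enters that row. The third corner
-- is a square because two lines cross there (`apex`). If φ is face tracing and S the passage along
-- a side, then φ⁴ = S³ = (φS)² = 1 on sides. These are the relations of the rotation group of the
-- octahedron, so eight triangles fit together like the vertices of the cube and give a covering of
-- `G` by C_k (`goodeyCover`). By Euler's formula `G` has six squares, and C_k has too few corners
-- for a second sheet.
--
-- For the algorithm: every line system contains all lines that meet a square, and these lines form
-- a line system unless there is a pentagon, or one of them enters a triangle, or two of them cross
-- in a hexagon (`exists_lineSystem_iff`). This is tested dart by dart, following each line for as
-- many steps as there are darts.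

universe u

namespace BarnetteColoring

open Function Equiv

/-! ### Cycles of permutations of a finite set -/

section Cycles

variable {D : Type*} [Finite D]

theorem mem_periodicPts_perm (π : Perm D) (d : D) : d ∈ periodicPts π :=
  π.injective.mem_periodicPts d

theorem minimalPeriod_perm_apply (π : Perm D) (d : D) :
    minimalPeriod π (π d) = minimalPeriod π d :=
  minimalPeriod_apply (mem_periodicPts_perm π d)

theorem minimalPeriod_sameCycle (π : Perm D) {d e : D} (h : π.SameCycle d e) :
    minimalPeriod π e = minimalPeriod π d := by
  obtain ⟨i, -, -, rfl⟩ := h.exists_pow_eq''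
  rw [← Perm.iterate_eq_pow]
  exact minimalPeriod_apply_iterate (mem_periodicPts_perm π d) i

theorem ncard_sameCycle (π : Perm D) (d : D) :
    {e | π.SameCycle d e}.ncard = minimalPeriod π d := by
  have h : {e | π.SameCycle d e} = (fun i => π^[i] d) '' Set.Iio (minimalPeriod π d) := by
    ext e
    constructor
    · intro he
      obtain ⟨i, -, -, rfl⟩ := Perm.SameCycle.exists_pow_eq'' he
      refine ⟨i % minimalPeriod π d, Nat.mod_lt _ ?_, ?_⟩
      · exact minimalPeriod_pos_of_mem_periodicPts (mem_periodicPts_perm π d)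
      · simp only [iterate_mod_minimalPeriod_eq, Perm.iterate_eq_pow]
    · rintro ⟨i, -, rfl⟩
      exact ⟨i, by simp [Perm.iterate_eq_pow]⟩
  rw [h, iterate_injOn_Iio_minimalPeriod.ncard_image, Set.ncard_eq_toFinset_card',
    Set.toFinset_Iio, Nat.card_Iio]

end Cycles

/-! ### Cubic rotation systems -/

namespace RotationSystem

variable {V : Type u} {G : SimpleGraph V} (R : RotationSystem G)

instance finite_dart [Finite V] : Finite G.Dart :=
  Finite.of_injective (fun d : G.Dart => d.toProd) (SimpleGraph.Dart.toProd_injective)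

theorem facePerm_apply (d : G.Dart) : R.facePerm d = R.rot d.symm := rfl

theorem facePerm_fst (d : G.Dart) : (R.facePerm d).fst = d.snd := R.rot_fst d.symm

theorem sameCycle_rot_iff (d e : G.Dart) : R.rot.SameCycle d e ↔ d.fst = e.fst := by
  refine ⟨?_, R.sameCycle d e⟩
  rintro ⟨i, rfl⟩
  have key : ∀ (n : ℕ) (x : G.Dart), ((R.rot ^ n) x).fst = x.fst := by
    intro n
    induction n with
    | zero => simp
    | succ n ih => intro x; rw [pow_succ, Perm.mul_apply, ih, R.rot_fst]
  obtain ⟨n, rfl | rfl⟩ := i.eq_nat_or_neg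
  · rw [zpow_natCast, key]
  · have := key n ((R.rot ^ (-(n : ℤ))) d)
    rw [zpow_neg, zpow_natCast, ← Perm.mul_apply, mul_inv_cancel, Perm.one_apply] at this
    rw [zpow_neg, zpow_natCast, this]

theorem faceSize_faceOf [Finite V] (d : G.Dart) : R.faceSize (R.faceOf d) = minimalPeriod R.facePerm d := by
  rw [← ncard_sameCycle]
  unfold faceSize faceOf
  congr 1
  ext e
  exact Quotient.eq.trans ⟨fun h => Perm.SameCycle.symm h, fun h => Perm.SameCycle.symm h⟩

theorem ncard_darts_fst (v : V) : {d : G.Dart | d.fst = v}.ncard = (G.neighborSet v).ncard := by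
  have h : {d : G.Dart | d.fst = v} = Set.range (G.dartOfNeighborSet v) := by
    ext d
    constructor
    · rintro rfl
      exact ⟨⟨d.snd, d.adj⟩, rfl⟩
    · rintro ⟨w, rfl⟩
      rfl
  rw [h, ← Set.image_univ, Set.ncard_image_of_injective _ (G.dartOfNeighborSet_injective v),
    Set.ncard_univ, Nat.card_coe_set_eq]

/-- All vertices have degree three. -/
def _root_.BarnetteColoring.IsCubic (G : SimpleGraph V) : Prop := ∀ v, (G.neighborSet v).ncard = 3

variable {R}

theorem minimalPeriod_rot [Finite V] (hG : IsCubic G) (d : G.Dart) : minimalPeriod R.rot d = 3 := by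
  rw [← ncard_sameCycle, ← hG d.fst, ← ncard_darts_fst]
  congr 1
  ext e
  simp [sameCycle_rot_iff, eq_comm]

theorem rot_rot_rot [Finite V] (hG : IsCubic G) (d : G.Dart) : R.rot (R.rot (R.rot d)) = d := by
  have := iterate_minimalPeriod (f := R.rot) (x := d)
  rwa [minimalPeriod_rot hG] at this

theorem rot_ne [Finite V] (hG : IsCubic G) (d : G.Dart) : R.rot d ≠ d := by
  intro h
  have := minimalPeriod_eq_one_iff_isFixedPt.2 h
  rw [minimalPeriod_rot hG] at this
  omega

theorem rot_rot_ne [Finite V] (hG : IsCubic G) (d : G.Dart) : R.rot (R.rot d) ≠ d := by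
  intro h
  apply rot_ne hG d
  have := rot_rot_rot (R := R) hG d
  rwa [h] at this

theorem snd_ne_of_fst_eq {d e : G.Dart} (h : d.fst = e.fst) (hne : d ≠ e) : d.snd ≠ e.snd :=
  fun h' => hne (SimpleGraph.Dart.ext _ _ (Prod.ext h h'))

theorem eq_of_fst_eq [Finite V] (hG : IsCubic G) {d e : G.Dart} (h : d.fst = e.fst) :
    e = d ∨ e = R.rot d ∨ e = R.rot (R.rot d) := by
  have he := R.sameCycle d e h
  have : e ∈ (fun i => R.rot^[i] d) '' Set.Iio 3 := by
    obtain ⟨i, -, -, rfl⟩ := he.exists_pow_eq''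
    refine ⟨i % 3, Nat.mod_lt _ (by norm_num), ?_⟩
    rw [← minimalPeriod_rot (R := R) hG d]
    simp only [iterate_mod_minimalPeriod_eq, Perm.iterate_eq_pow]
  obtain ⟨i, hi, rfl⟩ := this
  simp only [Set.mem_Iio] at hi
  interval_cases i <;> simp

end RotationSystem

/-! ### Line systems -/

/-- A system of straight lines in a cubic map with face permutation `φ` and edge flip `α`: a set
of darts closed under the flip that contains all darts of faces of size four, no dart of a face of
size three, and at most two darts of every face of size six, which are then opposite. -/
structure LineSystem {D : Type*} (φ α : Perm D) (B : Set D) : Prop where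
  flip : ∀ d ∈ B, α d ∈ B
  period : ∀ d, minimalPeriod φ d = 3 ∨ minimalPeriod φ d = 4 ∨ minimalPeriod φ d = 6
  tri : ∀ d, minimalPeriod φ d = 3 → d ∉ B
  sq : ∀ d, minimalPeriod φ d = 4 → d ∈ B
  opp : ∀ d, minimalPeriod φ d = 6 → d ∈ B → φ (φ (φ d)) ∈ B
  adj : ∀ d, minimalPeriod φ d = 6 → d ∈ B → φ d ∉ B

/-- The permutation that reverses all darts. -/
def dartFlip {V : Type*} (G : SimpleGraph V) : Perm G.Dart :=
  (SimpleGraph.Dart.symm_involutive (G := G)).toPerm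

theorem dartFlip_apply {V : Type*} {G : SimpleGraph V} (d : G.Dart) : dartFlip G d = d.symm := rfl

/-! ### Colorings yield line systems. -/

section Coloring

variable {V : Type u} [Finite V] {G : SimpleGraph V} {R : RotationSystem G}

open RotationSystem

/-- The darts across which a coloring reverses the orientation. -/
def reversingDarts (R : RotationSystem G) (c : V → Fin 4) : Set G.Dart :=
  {d | c (R.rot d).snd = c (R.rot d.symm).snd}

/-- Let `d = φ e` lead from u to v. The two colors not used by u and v occur on the other two
neighbors of u, one of which is the tail of `e`. The head of `φ d` has one of these two colors, so
it agrees with the one neighbor exactly when it differs from the other. -/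
theorem mem_reversingDarts_facePerm {c : V → Fin 4} (hG : IsCubic G)
    (hc : ∀ v, Set.InjOn c (insert v (G.neighborSet v))) (e : G.Dart) :
    R.facePerm e ∈ reversingDarts R c ↔
      c (R.facePerm (R.facePerm (R.facePerm e))).fst ≠ c e.fst := by
  set d := R.facePerm e with hd
  have hrr : e.fst = (R.rot (R.rot d)).snd := by
    rw [hd, facePerm_apply, rot_rot_rot hG]; rfl
  have h1 : (R.rot d).fst = d.fst := R.rot_fst d
  have h2 : (R.rot (R.rot d)).fst = d.fst := by rw [R.rot_fst, R.rot_fst]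
  have h3 : (R.rot d.symm).fst = d.snd := R.rot_fst d.symm
  have a0 := d.adj
  have a1 : G.Adj d.fst (R.rot d).snd := h1 ▸ (R.rot d).adj
  have a2 : G.Adj d.fst (R.rot (R.rot d)).snd := h2 ▸ (R.rot (R.rot d)).adj
  have a3 : G.Adj d.snd (R.rot d.symm).snd := h3 ▸ (R.rot d.symm).adj
  have key : ∀ {v x y : V}, G.Adj v x → G.Adj v y → x ≠ y → c x ≠ c y := fun hx hy hne h =>
    hne (hc _ (Set.mem_insert_of_mem _ hx) (Set.mem_insert_of_mem _ hy) h)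
  have key' : ∀ {v x : V}, G.Adj v x → c v ≠ c x := fun hx h =>
    hx.ne (hc _ (Set.mem_insert _ _) (Set.mem_insert_of_mem _ hx) h)
  have n1 := key a1 a0 (snd_ne_of_fst_eq h1 (rot_ne hG d))
  have n2 := key a2 a0 (snd_ne_of_fst_eq h2 (rot_rot_ne hG d))
  have n3 := key a2 a1 (snd_ne_of_fst_eq (h2.trans h1.symm) (rot_ne hG _))
  have n4 : c (R.rot d.symm).snd ≠ c d.fst :=
    key a3 d.adj.symm (snd_ne_of_fst_eq h3 (rot_ne hG d.symm))
  have n5 := key' a0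
  have n6 := key' a1
  have n7 := key' a2
  have n8 := key' a3
  rw [facePerm_fst, facePerm_apply, hrr]
  change _ = _ ↔ _
  clear_value d
  generalize c (R.rot d).snd = x1 at *
  generalize c (R.rot (R.rot d)).snd = x2 at *
  generalize c (R.rot d.symm).snd = x3 at *
  generalize c d.fst = x4 at *
  generalize c d.snd = x5 at *
  clear hd hrr h1 h2 h3 a0 a1 a2 a3 key key' hc
  revert x1 x2 x3 x4 x5
  decide

theorem color_facePerm_ne {c : V → Fin 4} (hG : IsCubic G)
    (hc : ∀ v, Set.InjOn c (insert v (G.neighborSet v))) (e : G.Dart) :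
    c e.fst ≠ c (R.facePerm e).fst ∧ c e.fst ≠ c (R.facePerm (R.facePerm e)).fst := by
  have h3 : (R.rot e.symm).fst = e.snd := R.rot_fst e.symm
  have a3 : G.Adj e.snd (R.rot e.symm).snd := h3 ▸ (R.rot e.symm).adj
  rw [facePerm_fst, facePerm_fst, facePerm_apply]
  refine ⟨fun h => e.adj.ne (hc _ (Set.mem_insert _ _) (Set.mem_insert_of_mem _ e.adj) h),
    fun h => ?_⟩
  exact snd_ne_of_fst_eq h3 (rot_ne hG e.symm)
    (hc _ (Set.mem_insert_of_mem _ a3) (Set.mem_insert_of_mem _ e.adj.symm) h.symm)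

/-- The colors around a face form a cyclic word in which letters at distance one or two differ. In
length five all letters would be distinct. In length six a color can be repeated only at antipodal
places, so with four colors at least two of the three antipodal pairs agree. -/
theorem lineSystem_of_coloring (hG : IsCubic G) {c : V → Fin 4}
    (hc : ∀ v, Set.InjOn c (insert v (G.neighborSet v)))
    (hsize : ∀ f : R.Face, R.faceSize f = 3 ∨ R.faceSize f = 4 ∨ R.faceSize f = 5 ∨
      R.faceSize f = 6) : LineSystem R.facePerm (dartFlip G) (reversingDarts R c) := by
  set φ := R.facePerm
  have hB := mem_reversingDarts_facePerm (R := R) hG hc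
  have hne := color_facePerm_ne (R := R) hG hc
  have hper : ∀ d n, minimalPeriod φ d = n → φ^[n] d = d := by
    rintro d n rfl
    exact iterate_minimalPeriod
  have hprev : ∀ d, ∃ e, d = φ e := fun d => ⟨φ.symm d, by simp⟩
  refine ⟨fun d hd => ?_, fun d => ?_, fun d hd => ?_, fun d hd => ?_, fun d hd => ?_,
    fun d hd => ?_⟩
  · exact Eq.symm hd
  · have := hsize (R.faceOf d)
    rw [faceSize_faceOf] at this
    have h5 : minimalPeriod φ d ≠ 5 := by
      intro h
      have h' := hper d 5 h
      simp only [iterate_succ, iterate_zero, comp_apply, id] at h'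
      have h0 := hne d
      have h1 := hne (φ d)
      have h2 := hne (φ (φ d))
      have h3 := hne (φ (φ (φ d)))
      have h4 := hne (φ (φ (φ (φ d))))
      rw [h'] at h3 h4
      generalize c d.fst = y0 at *
      generalize c (φ d).fst = y1 at *
      generalize c (φ (φ d)).fst = y2 at *
      generalize c (φ (φ (φ d))).fst = y3 at *
      generalize c (φ (φ (φ (φ d)))).fst = y4 at *
      clear this h h' hB hne
      grind
    tauto
  · obtain ⟨e, rfl⟩ := hprev d
    rw [minimalPeriod_perm_apply] at hd
    have := hper e 3 hd
    simp only [iterate_succ, iterate_zero, comp_apply, id] at this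
    rw [hB, this]
    simp
  · obtain ⟨e, rfl⟩ := hprev d
    rw [minimalPeriod_perm_apply] at hd
    have h := hper e 4 hd
    simp only [iterate_succ, iterate_zero, comp_apply, id] at h
    rw [hB]
    have := (hne (φ (φ (φ e)))).1
    rwa [h] at this
  · obtain ⟨e, rfl⟩ := hprev d
    rw [minimalPeriod_perm_apply] at hd
    have h := hper e 6 hd
    simp only [iterate_succ, iterate_zero, comp_apply, id] at h
    rw [hB, hB, h]
    exact Ne.symm
  · obtain ⟨e, rfl⟩ := hprev d
    rw [minimalPeriod_perm_apply] at hd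
    have h := hper e 6 hd
    simp only [iterate_succ, iterate_zero, comp_apply, id] at h
    rw [hB, hB]
    have h0 := hne e
    have h1 := hne (φ e)
    have h2 := hne (φ (φ e))
    have h3 := hne (φ (φ (φ e)))
    have h4 := hne (φ (φ (φ (φ e))))
    have h5 := hne (φ (φ (φ (φ (φ e)))))
    rw [h] at h4 h5
    generalize c e.fst = y0 at *
    generalize c (φ e).fst = y1 at *
    generalize c (φ (φ e)).fst = y2 at *
    generalize c (φ (φ (φ e))).fst = y3 at *
    generalize c (φ (φ (φ (φ e)))).fst = y4 at *
    generalize c (φ (φ (φ (φ (φ e))))).fst = y5 at *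
    clear h hd hB hne
    grind

end Coloring


open Function Equiv

/-! ### The genus of a map is nonnegative -/

/-- The cycles (including fixed points) of a permutation. -/
abbrev Cycles {X : Type*} (π : Perm X) : Type _ := Quotient (Perm.SameCycle.setoid π)

/-- The equivalence relation whose classes are the orbits of the group generated by two
permutations. -/
def jointOrbit {X : Type*} (σ α : Perm X) : Setoid X :=
  Perm.SameCycle.setoid σ ⊔ Perm.SameCycle.setoid α

section Genus

variable {X : Type*}

theorem sameCycle_apply_right_self (π : Perm X) (x : X) : π.SameCycle x (π x) := ⟨1, by simp⟩

theorem jointOrbit_left (σ α : Perm X) (x : X) : jointOrbit σ α x (σ x) :=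
  Setoid.le_def.1 (le_sup_left (a := Perm.SameCycle.setoid σ)) (sameCycle_apply_right_self σ x)

theorem jointOrbit_right (σ α : Perm X) (x : X) : jointOrbit σ α x (α x) :=
  Setoid.le_def.1 (le_sup_right (b := Perm.SameCycle.setoid α)) (sameCycle_apply_right_self α x)

theorem eq_of_sameCycle {β : Sort*} {π : Perm X} {f : X → β} (h : ∀ x, f (π x) = f x) {x y : X}
    (hxy : π.SameCycle x y) : f x = f y := by
  obtain ⟨i, rfl⟩ := hxy
  have key : ∀ (n : ℕ) (x : X), f ((π ^ n) x) = f x := by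
    intro n
    induction n with
    | zero => simp
    | succ n ih => intro x; rw [pow_succ, Perm.mul_apply, ih, h]
  obtain ⟨n, rfl | rfl⟩ := i.eq_nat_or_neg
  · rw [zpow_natCast, key]
  · have := key n ((π ^ (-(n : ℤ))) x)
    rw [zpow_neg, zpow_natCast, ← Perm.mul_apply, mul_inv_cancel, Perm.one_apply] at this
    rw [zpow_neg, zpow_natCast, this]

theorem eq_of_jointOrbit {β : Type*} {σ α : Perm X} {f : X → β} (hσ : ∀ x, f (σ x) = f x)
    (hα : ∀ x, f (α x) = f x) {x y : X} (h : jointOrbit σ α x y) : f x = f y := by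
  have : jointOrbit σ α ≤ Setoid.ker f :=
    sup_le (fun _ _ h => eq_of_sameCycle hσ h) (fun _ _ h => eq_of_sameCycle hα h)
  exact this h

/-- The antisymmetrization of a function that is constant on the cycles of `π`. -/
noncomputable def antisymm (π α : Perm X) : (Cycles π → ℝ) →ₗ[ℝ] (X → ℝ) :=
  (LinearMap.id - LinearMap.funLeft ℝ ℝ α) ∘ₗ LinearMap.funLeft ℝ ℝ (Quotient.mk _)

theorem antisymm_apply (π α : Perm X) (h : Cycles π → ℝ) (x : X) :
    antisymm π α h x = h (Quotient.mk _ x) - h (Quotient.mk _ (α x)) := rfl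

variable [Finite X]

/-- Rank and nullity: a kernel element is invariant under `π` and `α`, hence under `σ` by `hπ`,
hence constant on joint orbits. The form with `hπ` covers both `π = σ` (vertices) and `π = σ * α`
(faces). -/
theorem card_cycles_le_finrank_range_antisymm (π σ α : Perm X)
    (hπ : ∀ f : X → ℝ, (∀ x, f (π x) = f x) → (∀ x, f (α x) = f x) → ∀ x, f (σ x) = f x) :
    Nat.card (Cycles π) ≤
      Module.finrank ℝ (antisymm π α).range + Nat.card (Quotient (jointOrbit σ α)) := by
  have := Fintype.ofFinite (Cycles π)
  have := Fintype.ofFinite (Quotient (jointOrbit σ α))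
  have h1 := LinearMap.finrank_range_add_finrank_ker (antisymm π α)
  have h2 : Module.finrank ℝ (antisymm π α).ker ≤ Nat.card (Quotient (jointOrbit σ α)) := by
    let L : (Quotient (jointOrbit σ α) → ℝ) →ₗ[ℝ] (X → ℝ) := LinearMap.funLeft ℝ ℝ (Quotient.mk _)
    let M : (antisymm π α).ker →ₗ[ℝ] (X → ℝ) :=
      LinearMap.funLeft ℝ ℝ (Quotient.mk _) ∘ₗ (antisymm π α).ker.subtype
    have hM : Injective M :=
      (LinearMap.funLeft_injective_of_surjective ℝ ℝ _ Quotient.mk_surjective).comp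
        Subtype.val_injective
    have hle : M.range ≤ L.range := by
      rintro f ⟨⟨h, hh⟩, rfl⟩
      have hα : ∀ x, h (Quotient.mk _ (α x)) = h (Quotient.mk _ x) := fun x => by
        have := congrFun (LinearMap.mem_ker.1 hh) x
        rw [antisymm_apply] at this
        exact (sub_eq_zero.1 this).symm
      have hp : ∀ x, h (Quotient.mk _ (π x)) = h (Quotient.mk _ x) := fun x => by
        congr 1
        exact Quotient.sound (sameCycle_apply_right_self π x).symm
      have hs := hπ (fun x => h (Quotient.mk _ x)) hp hα
      exact ⟨Quotient.lift (fun x => h (Quotient.mk _ x)) fun x y hxy =>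
        eq_of_jointOrbit (f := fun x => h (Quotient.mk _ x)) hs hα hxy, rfl⟩
    calc _ = Module.finrank ℝ M.range := (LinearMap.finrank_range_of_inj hM).symm
      _ ≤ Module.finrank ℝ L.range := Submodule.finrank_mono hle
      _ ≤ Module.finrank ℝ (Quotient (jointOrbit σ α) → ℝ) := LinearMap.finrank_range_le L
      _ = _ := by rw [Module.finrank_fintype_fun_eq_card, Nat.card_eq_fintype_card]
  rw [Module.finrank_fintype_fun_eq_card] at h1
  rw [Nat.card_eq_fintype_card, ← h1]
  omega

/-- Differences of vertex potentials are orthogonal to differences of face potentials, like the cut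
space and the cycle space of a graph. A common element is orthogonal to itself. -/
theorem disjoint_range_antisymm {σ α : Perm X} (hα : ∀ x, α (α x) = x) :
    Disjoint (antisymm σ α).range (antisymm (σ * α) α).range := by
  have := Fintype.ofFinite X
  rw [Submodule.disjoint_def]
  rintro f ⟨h, rfl⟩ ⟨g, hg⟩
  have hh : ∀ x, h (Quotient.mk _ (σ x)) = h (Quotient.mk _ x) := fun x => by
    congr 1
    exact Quotient.sound (sameCycle_apply_right_self σ x).symm
  have hg' : ∀ x, g (Quotient.mk _ (α x)) = g (Quotient.mk _ (σ x)) := fun x => by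
    congr 1
    refine Quotient.sound ?_
    have := sameCycle_apply_right_self (σ * α) (α x)
    rwa [Perm.mul_apply, hα] at this
  have hsum : ∑ x, antisymm σ α h x * antisymm σ α h x = 0 := by
    conv_lhs =>
      enter [2, x, 2]
      rw [← hg]
    have e1 : ∑ x, h (Quotient.mk _ x) * g (Quotient.mk _ (α x)) = ∑ x, h (Quotient.mk _ x) * g (Quotient.mk _ x) := by
      rw [← Equiv.sum_comp σ (fun x => h (Quotient.mk _ x) * g (Quotient.mk _ x))]
      exact Finset.sum_congr rfl fun x _ => by rw [hh, hg']
    have e2 : ∑ x, h (Quotient.mk _ (α x)) * g (Quotient.mk _ x) = ∑ x, h (Quotient.mk _ x) * g (Quotient.mk _ (α x)) := by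
      rw [← Equiv.sum_comp α (fun x => h (Quotient.mk _ x) * g (Quotient.mk _ (α x)))]
      exact Finset.sum_congr rfl fun x _ => by rw [hα]
    have e3 : ∑ x, h (Quotient.mk _ (α x)) * g (Quotient.mk _ (α x)) = ∑ x, h (Quotient.mk _ x) * g (Quotient.mk _ x) :=
      Equiv.sum_comp α (fun x => h (Quotient.mk _ x) * g (Quotient.mk _ x))
    have e4 : ∀ x, antisymm σ α h x * antisymm (σ * α) α g x =
        h (Quotient.mk _ x) * g (Quotient.mk _ x) + h (Quotient.mk _ (α x)) * g (Quotient.mk _ (α x)) - h (Quotient.mk _ x) * g (Quotient.mk _ (α x)) - h (Quotient.mk _ (α x)) * g (Quotient.mk _ x) := fun x => by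
      rw [antisymm_apply, antisymm_apply]
      ring
    simp only [e4, Finset.sum_sub_distrib, Finset.sum_add_distrib]
    rw [e3, e2, e1]
    ring
  funext x
  have := (Finset.sum_eq_zero_iff_of_nonneg fun x _ => mul_self_nonneg _).1 hsum x
    (Finset.mem_univ x)
  simpa using this

/-- The number of vertices, edges and faces of a map on a closed surface. -/
theorem card_cycles_add_le {σ α : Perm X} (hα : ∀ x, α (α x) = x) :
    Nat.card (Cycles σ) + Nat.card (Cycles α) + Nat.card (Cycles (σ * α)) ≤
      Nat.card X + 2 * Nat.card (Quotient (jointOrbit σ α)) := by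
  have := Fintype.ofFinite X
  have := Fintype.ofFinite (Cycles α)
  have h1 := card_cycles_le_finrank_range_antisymm σ σ α (fun f h _ => h)
  have h2 := card_cycles_le_finrank_range_antisymm (σ * α) σ α (fun f h h' x => by
    have := h (α x)
    rwa [Perm.mul_apply, hα, h'] at this)
  let P : (Cycles α → ℝ) →ₗ[ℝ] (X → ℝ) := LinearMap.funLeft ℝ ℝ (Quotient.mk _)
  have h3 : Module.finrank ℝ P.range = Nat.card (Cycles α) := by
    rw [LinearMap.finrank_range_of_inj
      (LinearMap.funLeft_injective_of_surjective ℝ ℝ _ Quotient.mk_surjective),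
      Module.finrank_fintype_fun_eq_card, Nat.card_eq_fintype_card]
  -- Functions constant on edges are symmetric under `α`, elements of the other two ranges are
  -- antisymmetric.
  have h4 : Disjoint P.range ((antisymm σ α).range ⊔ (antisymm (σ * α) α).range) := by
    rw [Submodule.disjoint_def]
    rintro f ⟨h, rfl⟩ hf
    obtain ⟨_, ⟨a, rfl⟩, _, ⟨b, rfl⟩, hab⟩ := Submodule.mem_sup.1 hf
    funext x
    have e1 := congrFun hab x
    have e2 := congrFun hab (α x)
    simp only [Pi.add_apply, antisymm_apply, hα] at e1 e2
    have e3 : P h (α x) = P h x := by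
      change h (Quotient.mk _ (α x)) = h (Quotient.mk _ x)
      congr 1
      exact Quotient.sound (sameCycle_apply_right_self α x).symm
    rw [e3] at e2
    change P h x = 0
    linarith
  have h5 := Submodule.finrank_add_finrank_le_of_disjoint h4
  have h6 := Submodule.finrank_sup_add_finrank_inf_eq (antisymm σ α).range
    (antisymm (σ * α) α).range
  rw [(disjoint_range_antisymm hα).eq_bot, finrank_bot] at h6
  rw [Module.finrank_fintype_fun_eq_card, ← Nat.card_eq_fintype_card] at h5
  omega

end Genus

/-! ### Coverings of a map of genus zero -/

section Covering

variable {D S : Type*} [Group S]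

/-- The lift of a permutation to the covering given by a voltage assignment. -/
def voltageLift (π : Perm D) (w : D → S) : Perm (D × S) where
  toFun y := (π y.1, y.2 * w y.1)
  invFun y := (π.symm y.1, y.2 * (w (π.symm y.1))⁻¹)
  left_inv y := by simp
  right_inv y := by simp

theorem voltageLift_apply (π : Perm D) (w : D → S) (d : D) (g : S) :
    voltageLift π w (d, g) = (π d, g * w d) := rfl

theorem voltageLift_iterate_fst (π : Perm D) (w : D → S) (n : ℕ) (y : D × S) :
    ((voltageLift π w)^[n] y).1 = π^[n] y.1 := by
  induction n generalizing y with
  | zero => rfl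
  | succ n ih => rw [iterate_succ_apply, ih, iterate_succ_apply]; rfl

variable [Finite D] [Finite S]

/-- Going once around a cycle of `π` returns to the same sheet, so the points over one
representative lie on pairwise different cycles of the lift. -/
theorem card_cycles_mul_le_voltageLift {π : Perm D} {w : D → S}
    (h : ∀ d g, (voltageLift π w)^[minimalPeriod π d] (d, g) = (d, g)) :
    Nat.card (Cycles π) * Nat.card S ≤ Nat.card (Cycles (voltageLift π w)) := by
  rw [← Nat.card_prod]
  refine Nat.card_le_card_of_injective
    (fun y : Cycles π × S => (⟦(y.1.out, y.2)⟧ : Cycles (voltageLift π w))) ?_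
  rintro ⟨a, g⟩ ⟨b, g'⟩ hab
  obtain ⟨n, -, -, hn⟩ := Perm.SameCycle.exists_pow_eq'' (Quotient.exact hab)
  rw [← Perm.iterate_eq_pow] at hn
  have h1 := voltageLift_iterate_fst π w n (a.out, g)
  rw [hn] at h1
  have h2 : a = b := by
    rw [← a.out_eq, ← b.out_eq]
    refine Quotient.sound ⟨n, ?_⟩
    rw [zpow_natCast, ← Perm.iterate_eq_pow, ← h1]
  subst h2
  have h3 : IsPeriodicPt π n a.out := h1.symm
  obtain ⟨m, rfl⟩ := h3.minimalPeriod_dvd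
  have h4 : IsPeriodicPt (voltageLift π w) (minimalPeriod π a.out) (a.out, g) := h _ _
  rw [(h4.mul_const m).eq] at hn
  exact Prod.ext rfl (Prod.ext_iff.1 hn).2

/-- A voltage assignment on a map of genus zero that is trivial around vertices, edges and faces is
a coboundary. -/
theorem exists_potential {σ α : Perm D} (hα : ∀ x, α (α x) = x)
    (hconn : ∀ x y, jointOrbit σ α x y)
    (heuler : Nat.card (Cycles σ) + Nat.card (Cycles α) + Nat.card (Cycles (σ * α)) =
      Nat.card D + 2) (w a : D → S)
    (h0 : ∀ d g, (voltageLift σ w)^[minimalPeriod σ d] (d, g) = (d, g))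
    (h1 : ∀ d, a d * a (α d) = 1)
    (h1' : ∀ d g, (voltageLift α a)^[minimalPeriod α d] (d, g) = (d, g))
    (h2 : ∀ d g, (voltageLift (σ * α) (fun d => a d * w (α d)))^[minimalPeriod (σ * α) d] (d, g) =
      (d, g)) :
    ∃ g : D → S, ∀ d, g (σ d) = g d * w d ∧ g (α d) = g d * a d := by
  -- The lift of the face permutation is the product of the other two lifts, so the covering is
  -- again a map and the genus bound applies to it.
  have hmul : voltageLift σ w * voltageLift α a =
      voltageLift (σ * α) (fun d => a d * w (α d)) := by
    ext y
    · rfl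
    · exact mul_assoc _ _ _
  set r := jointOrbit (voltageLift σ w) (voltageLift α a) with hr
  have key := card_cycles_add_le (σ := voltageLift σ w) (α := voltageLift α a) (by
    rintro ⟨d, g⟩
    rw [voltageLift_apply, voltageLift_apply, hα, mul_assoc, h1, mul_one])
  rw [hmul, ← hr, Nat.card_prod] at key
  have k0 := card_cycles_mul_le_voltageLift h0
  have k1 := card_cycles_mul_le_voltageLift h1'
  have k2 := card_cycles_mul_le_voltageLift h2
  -- Multiplying Euler's formula of the base by `|S|` and comparing with the genus bound of the
  -- covering leaves at least `|S|` components.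
  have hcard : Nat.card S ≤ Nat.card (Quotient r) := by
    have : (Nat.card (Cycles σ) + Nat.card (Cycles α) + Nat.card (Cycles (σ * α))) * Nat.card S
        = Nat.card D * Nat.card S + 2 * Nat.card S := by rw [heuler]; ring
    simp only [add_mul] at this
    omega
  have hrσ : ∀ d g, (⟦(σ d, g * w d)⟧ : Quotient r) = ⟦(d, g)⟧ := fun d g =>
    Quotient.sound (r.symm' (jointOrbit_left (voltageLift σ w) (voltageLift α a) (d, g)))
  have hrα : ∀ d g, (⟦(α d, g * a d)⟧ : Quotient r) = ⟦(d, g)⟧ := fun d g =>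
    Quotient.sound (r.symm' (jointOrbit_right (voltageLift σ w) (voltageLift α a) (d, g)))
  -- As the base is connected, each component meets each fiber. By the count it does so exactly
  -- once, and one component is then the graph of the potential.
  have hsurj : ∀ d, Surjective fun g : S => (⟦(d, g)⟧ : Quotient r) := by
    intro d q
    induction q using Quotient.inductionOn with
    | h y =>
      obtain ⟨e, g⟩ := y
      let f : D → Prop := fun d => ∃ g' : S, (⟦(d, g')⟧ : Quotient r) = ⟦(e, g)⟧
      have hfσ : ∀ d, f (σ d) = f d := fun d => propext
        ⟨fun ⟨g', h⟩ => ⟨g' * (w d)⁻¹, by rw [← h, ← hrσ d]; simp⟩,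
          fun ⟨g', h⟩ => ⟨g' * w d, by rw [← h, ← hrσ d]⟩⟩
      have hfα : ∀ d, f (α d) = f d := fun d => propext
        ⟨fun ⟨g', h⟩ => ⟨g' * (a d)⁻¹, by rw [← h, ← hrα d]; simp⟩,
          fun ⟨g', h⟩ => ⟨g' * a d, by rw [← h, ← hrα d]⟩⟩
      have : f d := by
        rw [eq_of_jointOrbit hfσ hfα (hconn d e)]
        exact ⟨g, rfl⟩
      exact this
  have hinj : ∀ d, Injective fun g : S => (⟦(d, g)⟧ : Quotient r) := fun d =>
    ((Nat.bijective_iff_surjective_and_card _).2 ⟨hsurj d,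
      le_antisymm hcard (Nat.card_le_card_of_surjective _ (hsurj d))⟩).1
  rcases isEmpty_or_nonempty D with hD | ⟨⟨d₀⟩⟩
  · exact ⟨fun _ => 1, fun d => hD.elim d⟩
  choose g hg using fun d => hsurj d (Quotient.mk r (d₀, 1))
  refine ⟨g, fun d => ⟨hinj (σ d) ?_, hinj (α d) ?_⟩⟩
  · simp only [hg, hrσ]
  · simp only [hg, hrα]

end Covering


open Function Equiv RotationSystem

/-! ### Counting darts, vertices, edges and faces -/

section Counting

variable {V : Type u} {G : SimpleGraph V} {R : RotationSystem G}

theorem dartFlip_dartFlip (d : G.Dart) : dartFlip G (dartFlip G d) = d := d.symm_symm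

theorem sameCycle_dartFlip_iff (d e : G.Dart) :
    (dartFlip G).SameCycle d e ↔ d.edge = e.edge := by
  constructor
  · exact eq_of_sameCycle (f := fun d : G.Dart => d.edge) fun x => x.edge_symm
  · intro h
    rcases SimpleGraph.dart_edge_eq_iff d e |>.1 h with rfl | rfl
    · exact Perm.SameCycle.refl _ _
    · exact (sameCycle_apply_right_self (dartFlip G) e).symm

theorem minimalPeriod_dartFlip (d : G.Dart) : minimalPeriod (dartFlip G) d = 2 := by
  have h : IsPeriodicPt (dartFlip G) 2 d := dartFlip_dartFlip d
  have h1 : minimalPeriod (dartFlip G) d ≠ 1 := fun h1 =>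
    d.symm_ne (minimalPeriod_eq_one_iff_isFixedPt.1 h1)
  exact ((Nat.dvd_prime Nat.prime_two).1 h.minimalPeriod_dvd).resolve_left h1

theorem card_cycles_dartFlip : Nat.card (Cycles (dartFlip G)) = G.edgeSet.ncard := by
  rw [← Nat.card_coe_set_eq]
  refine Nat.card_congr (Equiv.ofBijective (Quotient.lift (fun d : G.Dart =>
    (⟨d.edge, d.edge_mem⟩ : G.edgeSet)) fun a b h => Subtype.ext
      ((sameCycle_dartFlip_iff a b).1 h)) ⟨?_, ?_⟩)
  · rintro ⟨a⟩ ⟨b⟩ h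
    exact Quotient.sound ((sameCycle_dartFlip_iff a b).2 (congrArg Subtype.val h))
  · rintro ⟨e, he⟩
    induction e with
    | h x y => exact ⟨Quotient.mk _ ⟨(x, y), he⟩, rfl⟩

theorem exists_dart_fst (hG : IsCubic G) (v : V) : ∃ d : G.Dart, d.fst = v := by
  have : {d : G.Dart | d.fst = v}.ncard ≠ 0 := by rw [ncard_darts_fst, hG v]; norm_num
  exact Set.nonempty_of_ncard_ne_zero this

theorem card_cycles_rot [Finite V] (hG : IsCubic G) : Nat.card (Cycles R.rot) = Nat.card V := by
  refine Nat.card_congr (Equiv.ofBijective (Quotient.lift (fun d : G.Dart => d.fst) fun a b h =>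
    (R.sameCycle_rot_iff a b).1 h) ⟨?_, ?_⟩)
  · rintro ⟨a⟩ ⟨b⟩ h
    exact Quotient.sound (R.sameCycle a b h)
  · intro v
    obtain ⟨d, hd⟩ := exists_dart_fst hG v
    exact ⟨Quotient.mk _ d, hd⟩

theorem card_eq_sum_minimalPeriod {D : Type*} [Finite D] (π : Perm D) :
    letI := Fintype.ofFinite (Cycles π)
    Nat.card D = ∑ c : Cycles π, minimalPeriod π c.out := by
  have := Fintype.ofFinite D
  let _ := Fintype.ofFinite (Cycles π)
  classical
  rw [Nat.card_eq_fintype_card, ← Finset.card_univ, Finset.card_eq_sum_card_fiberwise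
    (f := fun d => (Quotient.mk _ d : Cycles π)) (t := Finset.univ) (by simp)]
  refine Finset.sum_congr rfl fun c _ => ?_
  rw [← ncard_sameCycle, ← Set.ncard_coe_finset]
  congr 1
  ext d
  simp only [Finset.coe_filter, Finset.mem_univ, true_and, Set.mem_ofPred_eq]
  conv_lhs => rw [← c.out_eq]
  exact Quotient.eq.trans ⟨fun h => Perm.SameCycle.symm h, fun h => Perm.SameCycle.symm h⟩

theorem card_eq_mul_card_cycles {D : Type*} [Finite D] (π : Perm D) {n : ℕ}
    (h : ∀ d, minimalPeriod π d = n) : Nat.card D = n * Nat.card (Cycles π) := by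
  let _ := Fintype.ofFinite (Cycles π)
  rw [card_eq_sum_minimalPeriod π, Finset.sum_congr rfl fun c _ => h _, Finset.sum_const,
    Finset.card_univ, Nat.card_eq_fintype_card, smul_eq_mul, mul_comm]

/-- Each edge consists of two darts, so V − E + F = 2 becomes V + E + F = 2E + 2. -/
theorem card_cycles_add_eq [Finite V] (hG : IsCubic G) (hR : R.IsPlane) :
    Nat.card (Cycles R.rot) + Nat.card (Cycles (dartFlip G)) + Nat.card (Cycles R.facePerm) =
      Nat.card G.Dart + 2 := by
  have h1 := card_eq_mul_card_cycles (dartFlip G) minimalPeriod_dartFlip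
  have h2 := hR.2
  rw [← card_cycles_dartFlip, ← card_cycles_rot (R := R) hG] at h2
  change _ - _ + (Nat.card (Cycles R.facePerm) : ℤ) = 2 at h2
  omega

theorem jointOrbit_of_walk {u v : V} (p : G.Walk u v) (d e : G.Dart) (hd : d.fst = u)
    (he : e.fst = v) : jointOrbit R.rot (dartFlip G) d e := by
  have hrot : ∀ d e : G.Dart, d.fst = e.fst → jointOrbit R.rot (dartFlip G) d e := fun d e h =>
    Setoid.le_def.1 (le_sup_left (a := Perm.SameCycle.setoid R.rot)) (R.sameCycle d e h)
  induction p generalizing d with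
  | nil => exact hrot d e (hd.trans he.symm)
  | cons h p ih =>
    refine Setoid.trans' _ (hrot d ⟨(_, _), h⟩ hd) (Setoid.trans' _ (jointOrbit_right _ _ _)
      (ih _ rfl he))

end Counting

/-! ### Coloring along a line system -/

section Coloring

/-- The rotation of the colors seen from a dart: the tail keeps its place, the three neighbors are
permuted cyclically. -/
def turnPerm : Perm (Fin 4) := swap 1 2 * swap 2 3

/-- The change of the colors seen from a dart when it is flipped. -/
def flipPerm (b : Prop) [Decidable b] : Perm (Fin 4) :=
  if b then swap 0 1 else swap 0 1 * swap 2 3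

-- The factor of a non-reversing dart is a three-cycle x, that of a reversing dart a four-cycle y.
-- The possible face patterns give the products x³, y⁴, x⁶ and the rotations of (yxx)², all of them
-- trivial.
set_option maxRecDepth 8000 in
open Classical in
theorem voltageLift_face_trivial {D : Type*} [Finite D] {φ α : Perm D} {B : Set D}
    (hB : LineSystem φ α B) (d : D) (g : Perm (Fin 4)) :
    (voltageLift φ (fun d => flipPerm (d ∈ B) * turnPerm))^[minimalPeriod φ d] (d, g) = (d, g) := by
  have hp := iterate_minimalPeriod (f := φ) (x := d)
  rcases hB.period d with h | h | h <;> rw [h] at hp ⊢ <;>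
    simp only [iterate_succ, iterate_zero, comp_apply, id] at hp
  · have h0 := hB.tri d h
    have h1 := hB.tri (φ d) ((minimalPeriod_perm_apply _ _).trans h)
    have h2 := hB.tri (φ (φ d)) (by simpa [minimalPeriod_perm_apply] using h)
    simp only [iterate_succ, iterate_zero, comp_apply, id, voltageLift_apply, hp, h0, h1, h2,
      mul_assoc]
    refine Prod.ext rfl (mul_eq_left.2 ?_)
    simp only [flipPerm, if_false]
    decide
  · have h0 := hB.sq d h
    have h1 := hB.sq (φ d) ((minimalPeriod_perm_apply _ _).trans h)
    have h2 := hB.sq (φ (φ d)) (by simpa [minimalPeriod_perm_apply] using h)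
    have h3 := hB.sq (φ (φ (φ d))) (by simpa [minimalPeriod_perm_apply] using h)
    simp only [iterate_succ, iterate_zero, comp_apply, id, voltageLift_apply, hp, h0, h1, h2, h3,
      mul_assoc]
    refine Prod.ext rfl (mul_eq_left.2 ?_)
    simp only [flipPerm, if_true]
    decide
  · have hopp : ∀ e, minimalPeriod φ e = 6 → (φ (φ (φ e)) ∈ B ↔ e ∈ B) := by
      refine fun e he => ⟨fun h' => ?_, hB.opp e he⟩
      have := hB.opp _ (by simpa [minimalPeriod_perm_apply] using he) h'
      have hp := iterate_minimalPeriod (f := φ) (x := e)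
      rw [he] at hp
      simp only [iterate_succ, iterate_zero, comp_apply, id] at hp
      rwa [hp] at this
    have m1 : minimalPeriod φ (φ d) = 6 := (minimalPeriod_perm_apply _ _).trans h
    have m2 : minimalPeriod φ (φ (φ d)) = 6 := (minimalPeriod_perm_apply _ _).trans m1
    have o0 := hopp d h
    have o1 := hopp (φ d) m1
    have o2 := hopp (φ (φ d)) m2
    have a0 := hB.adj d h
    have a1 := hB.adj (φ d) m1
    have a2 := hB.adj (φ (φ d)) m2
    simp only [iterate_succ, iterate_zero, comp_apply, id, voltageLift_apply, hp, mul_assoc]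
    refine Prod.ext rfl (mul_eq_left.2 ?_)
    simp only [o0, o1, o2] at a2 ⊢
    by_cases b0 : d ∈ B <;> by_cases b1 : φ d ∈ B <;> by_cases b2 : φ (φ d) ∈ B <;>
      simp only [b0, b1, b2, not_true, imp_false] at a0 a1 a2 <;>
      simp only [flipPerm, b0, b1, b2, if_false, if_true] <;> decide

variable {V : Type u} [Finite V] {G : SimpleGraph V} {R : RotationSystem G}

/-- The potential gives for each dart the colors of its tail, its head and the two other neighbors
of the tail, in positions 0 to 3. Turning fixes position 0, so the tail color depends only on the
vertex. Flipping exchanges positions 0 and 1, so position 1 is the color of the head. Injectivity of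
the permutation does the rest. -/
theorem distanceTwoColorable_of_lineSystem (hG : IsCubic G) (hR : R.IsPlane) {B : Set G.Dart}
    (hB : LineSystem R.facePerm (dartFlip G) B) : DistanceTwoColorable G 4 := by
  classical
  have hflip : ∀ d, (dartFlip G d ∈ B) = (d ∈ B) := fun d => propext
    ⟨fun h => by simpa [dartFlip_dartFlip] using hB.flip _ h, hB.flip d⟩
  have h1 : ∀ d, flipPerm (d ∈ B) * flipPerm (dartFlip G d ∈ B) = 1 := fun d => by
    simp only [hflip]
    by_cases b : d ∈ B <;> simp only [flipPerm, b, if_false, if_true] <;> decide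
  obtain ⟨g, hg⟩ := exists_potential (S := Perm (Fin 4)) (σ := R.rot) (α := dartFlip G)
    dartFlip_dartFlip
    (fun d e => by
      obtain ⟨p⟩ := hR.1.preconnected d.fst e.fst
      exact jointOrbit_of_walk p d e rfl rfl)
    (card_cycles_add_eq hG hR) (fun _ => turnPerm) (fun d => flipPerm (d ∈ B))
    (fun d g => by
      rw [minimalPeriod_rot hG]
      simp only [iterate_succ, iterate_zero, comp_apply, id, voltageLift_apply, rot_rot_rot hG,
        mul_assoc]
      refine Prod.ext rfl (mul_eq_left.2 ?_)
      decide)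
    h1
    (fun d g => by
      rw [minimalPeriod_dartFlip]
      simp only [iterate_succ, iterate_zero, comp_apply, id, voltageLift_apply, dartFlip_dartFlip,
        mul_assoc, h1, mul_one])
    (voltageLift_face_trivial hB)
  have t0 : ∀ d, g (R.rot d) 0 = g d 0 := fun d => by
    rw [(hg d).1, Perm.mul_apply]; congr 1
  have t1 : ∀ d, g (R.rot d) 1 = g d 2 := fun d => by
    rw [(hg d).1, Perm.mul_apply]; congr 1
  have t2 : ∀ d, g (R.rot d) 2 = g d 3 := fun d => by
    rw [(hg d).1, Perm.mul_apply]; congr 1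
  have t3 : ∀ d, g (dartFlip G d) 0 = g d 1 := fun d => by
    rw [(hg d).2, Perm.mul_apply]
    congr 1
    by_cases b : d ∈ B <;> simp only [flipPerm, b, if_false, if_true] <;> decide
  choose s hs using exists_dart_fst hG
  have hc : ∀ d : G.Dart, g (s d.fst) 0 = g d 0 := fun d =>
    eq_of_sameCycle (f := fun d => g d 0) t0 (R.sameCycle _ _ (hs d.fst))
  have hc' : ∀ d : G.Dart, g (s d.snd) 0 = g d 1 := fun d => by
    rw [← t3 d]
    exact hc (dartFlip G d)
  refine ⟨fun v => g (s v) 0, fun v => ?_⟩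
  have hadj : ∀ x, G.Adj v x → ∃ d : G.Dart, d.fst = v ∧ d.snd = x := fun x hx =>
    ⟨⟨(v, x), hx⟩, rfl, rfl⟩
  have hne : ∀ x, G.Adj v x → g (s v) 0 ≠ g (s x) 0 := by
    intro x hx
    obtain ⟨d, rfl, rfl⟩ := hadj x hx
    rw [hc, hc']
    exact (g d).injective.ne (by decide)
  rintro x (rfl | hx) y (rfl | hy) hxy
  · rfl
  · exact absurd hxy (hne y hy)
  · exact absurd hxy.symm (hne x hx)
  · obtain ⟨d, hd, rfl⟩ := hadj x hx
    obtain ⟨e, he, rfl⟩ := hadj y hy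
    simp only [hc'] at hxy
    rcases eq_of_fst_eq (R := R) hG (hd.trans he.symm) with rfl | rfl | rfl
    · rfl
    · rw [t1] at hxy
      exact absurd ((g d).injective hxy) (by decide)
    · rw [t1, t2] at hxy
      exact absurd ((g d).injective hxy) (by decide)

end Coloring


open Function Equiv RotationSystem

/-! ### Goodey graphs -/

section Goodey

variable {k : ℕ}

theorem GoodeyVertex.ext {x y : GoodeyVertex k} (h1 : x.1 = y.1) (h2 : x.2.1 = y.2.1) : x = y :=
  Prod.ext h1 (Subtype.ext h2)

instance : Finite (GoodeyVertex k) := by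
  refine Finite.of_injective (β := (Fin 3 → Bool) × (Fin 3 → Fin (k + 1)))
    (fun x => (x.1, fun i => ⟨x.2.1 i, ?_⟩)) ?_
  · have := x.2.2
    fin_cases i <;> simp <;> omega
  · intro x y h
    obtain ⟨h1, h2⟩ := Prod.ext_iff.1 h
    exact GoodeyVertex.ext h1 (funext fun i => congrArg Fin.val (congrFun h2 i))

/-- Adjacency in the Goodey graph in the direction `r`. -/
def GoodeyDir (r : Fin 3) (x y : GoodeyVertex k) : Prop :=
  (x.1 = y.1 ∧ (y.2.1 = x.2.1 + Pi.single r 1 ∨ x.2.1 = y.2.1 + Pi.single r 1)) ∨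
    (x.2 = y.2 ∧ x.2.1 0 + x.2.1 1 + x.2.1 2 = k ∧ x.2.1 r = 0 ∧ y.1 = update x.1 r (!x.1 r))

theorem forall_ne_iff_eq_update (a b : Fin 3 → Bool) (r : Fin 3) :
    (∀ j, a j ≠ b j ↔ j = r) ↔ b = update a r (!a r) := by
  constructor
  · intro h
    funext j
    by_cases hj : j = r
    · subst hj
      have := (h j).2 rfl
      rw [update_self]
      revert this
      cases a j <;> cases b j <;> decide
    · rw [update_of_ne hj]
      exact (not_not.1 (mt (h j).1 hj)).symm
  · rintro rfl j
    by_cases hj : j = r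
    · subst hj; simp
    · simp [hj]

theorem goodeyGraph_adj_iff (x y : GoodeyVertex k) :
    (goodeyGraph k).Adj x y ↔ ∃ r, GoodeyDir r x y := by
  constructor
  · rintro (⟨h, i, hi⟩ | ⟨h, i, hi⟩ | ⟨h, h', i, hi, hj⟩)
    · exact ⟨i, Or.inl ⟨h, Or.inl hi⟩⟩
    · exact ⟨i, Or.inl ⟨h.symm, Or.inr hi⟩⟩
    · exact ⟨i, Or.inr ⟨h, h', hi, (forall_ne_iff_eq_update _ _ _).1 hj⟩⟩
  · rintro ⟨i, ⟨h, hi | hi⟩ | ⟨h, h', hi, hj⟩⟩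
    · exact Or.inl ⟨h, i, hi⟩
    · exact Or.inr (Or.inl ⟨h.symm, i, hi⟩)
    · exact Or.inr (Or.inr ⟨h, h', i, hi, (forall_ne_iff_eq_update _ _ _).2 hj⟩)

theorem sum_add_single (t : Fin 3 → ℕ) (r : Fin 3) :
    (t + Pi.single r 1 : Fin 3 → ℕ) 0 + (t + Pi.single r 1 : Fin 3 → ℕ) 1 +
      (t + Pi.single r 1 : Fin 3 → ℕ) 2 = t 0 + t 1 + t 2 + 1 := by
  fin_cases r <;> simp <;> omega

theorem GoodeyDir.unique {r : Fin 3} {x y z : GoodeyVertex k} (hy : GoodeyDir r x y)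
    (hz : GoodeyDir r x z) : y = z := by
  have hx := x.2.2
  have hy' := y.2.2
  have hz' := z.2.2
  have sx := sum_add_single x.2.1 r
  have sy := sum_add_single y.2.1 r
  have sz := sum_add_single z.2.1 r
  rcases hy with ⟨h1, h2 | h2⟩ | ⟨h1, h2, h3, h4⟩ <;>
    rcases hz with ⟨h1', h2' | h2'⟩ | ⟨h1', h2', h3', h4'⟩
  · exact GoodeyVertex.ext (h1.symm.trans h1') (h2.trans h2'.symm)
  · rw [← h2] at sx; rw [← h2'] at sz; omega
  · rw [← h2] at sx; omega
  · rw [← h2'] at sx; rw [← h2] at sy; omega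
  · exact GoodeyVertex.ext (h1.symm.trans h1') (add_right_cancel (h2.symm.trans h2'))
  · rw [h2] at h3'; simp at h3'
  · rw [← h2'] at sx; omega
  · rw [h2'] at h3; simp at h3
  · exact Prod.ext (h4.trans h4'.symm) (h1.symm.trans h1')

theorem GoodeyDir.exists (r : Fin 3) (x : GoodeyVertex k) : ∃ y, GoodeyDir r x y := by
  obtain ⟨ε, t, ht | ht⟩ := x
  · by_cases h0 : t r = 0
    · exact ⟨(update ε r (!ε r), ⟨t, Or.inl ht⟩), Or.inr ⟨rfl, ht, h0, rfl⟩⟩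
    · have h1 : t - Pi.single r 1 + Pi.single r 1 = t := by
        funext j
        by_cases hj : j = r
        · subst hj; simp; omega
        · simp [hj]
      have h2 := sum_add_single (t - Pi.single r 1) r
      rw [h1, ht] at h2
      exact ⟨(ε, ⟨t - Pi.single r 1, Or.inr h2.symm⟩), Or.inl ⟨rfl, Or.inr h1.symm⟩⟩
  · exact ⟨(ε, ⟨t + Pi.single r 1, Or.inl (by rw [sum_add_single]; omega)⟩),
      Or.inl ⟨rfl, Or.inl rfl⟩⟩

/-- A distance-two coloring of the Goodey graph. -/
def goodeyColor (x : GoodeyVertex k) : ZMod 2 × ZMod 2 :=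
  (x.2.1 1 + x.2.1 2 + (x.1 1).toNat + (x.1 2).toNat,
    x.2.1 0 + x.2.1 2 + (x.1 0).toNat + (x.1 2).toNat)

/-- The change of color in a direction. -/
def goodeyShift : Fin 3 → ZMod 2 × ZMod 2 := ![(0, 1), (1, 0), (1, 1)]

/-- The three directions act on colors by the three nonzero elements of the Klein four-group, both
inside a patch and across a side. Hence a vertex and its neighbors receive all four colors. -/
theorem goodeyColor_of_dir {r : Fin 3} {x y : GoodeyVertex k} (h : GoodeyDir r x y) :
    goodeyColor y = goodeyColor x + goodeyShift r := by
  obtain ⟨ε, t, ht⟩ := x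
  obtain ⟨ε', t', ht'⟩ := y
  have two : (2 : ZMod 2) = 0 := rfl
  have hb : ∀ b : Bool, ((!b).toNat : ZMod 2) = b.toNat + 1 := by decide
  rcases h with ⟨h1, h2 | h2⟩ | ⟨h1, h2, h3, h4⟩
  · simp only at h1 h2
    subst h1 h2
    fin_cases r <;> simp [goodeyColor, goodeyShift] <;> ring_nf <;> simp
  · simp only at h1 h2
    subst h1 h2
    fin_cases r <;> simp [goodeyColor, goodeyShift] <;> ring_nf <;> simp [two]
  · simp only [Subtype.mk.injEq] at h1 h4
    subst h1 h4
    fin_cases r <;> simp [goodeyColor, goodeyShift, hb] <;> ring_nf <;> simp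

theorem goodeyGraph_distanceTwoColorable (k : ℕ) : DistanceTwoColorable (goodeyGraph k) 4 := by
  have e : ZMod 2 × ZMod 2 ≃ Fin 4 := Fintype.equivFinOfCardEq (by simp)
  have hs : ∀ r, goodeyShift r ≠ 0 := by decide
  have hi : Injective goodeyShift := by decide
  refine ⟨fun x => e (goodeyColor x), fun v => e.injective.comp_injOn ?_⟩
  rintro x (rfl | hx) y (rfl | hy) hxy
  · rfl
  · obtain ⟨r, hr⟩ := (goodeyGraph_adj_iff _ _).1 hy
    rw [goodeyColor_of_dir hr, left_eq_add] at hxy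
    exact absurd hxy (hs r)
  · obtain ⟨r, hr⟩ := (goodeyGraph_adj_iff _ _).1 hx
    rw [goodeyColor_of_dir hr, add_eq_left] at hxy
    exact absurd hxy (hs r)
  · obtain ⟨r, hr⟩ := (goodeyGraph_adj_iff _ _).1 hx
    obtain ⟨r', hr'⟩ := (goodeyGraph_adj_iff _ _).1 hy
    rw [goodeyColor_of_dir hr, goodeyColor_of_dir hr', add_right_inj] at hxy
    obtain rfl := hi hxy
    exact hr.unique hr'

theorem DistanceTwoColorable.of_iso {V W : Type*} {G : SimpleGraph V} {H : SimpleGraph W}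
    (e : G ≃g H) {r : ℕ} (h : DistanceTwoColorable H r) : DistanceTwoColorable G r := by
  obtain ⟨c, hc⟩ := h
  refine ⟨c ∘ e, fun v x hx y hy hxy => e.injective (hc (e v) ?_ ?_ hxy)⟩
  · rcases hx with rfl | hx
    · exact Set.mem_insert _ _
    · exact Set.mem_insert_of_mem _ (e.map_adj_iff.2 hx)
  · rcases hy with rfl | hy
    · exact Set.mem_insert _ _
    · exact Set.mem_insert_of_mem _ (e.map_adj_iff.2 hy)

end Goodey

theorem sameCycle_out {X : Type*} (π : Perm X) (x : X) :
    π.SameCycle (Quotient.mk _ x : Cycles π).out x :=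
  Quotient.exact (Quotient.out_eq (Quotient.mk _ x : Cycles π))

/-! ### Coverings of a plane cubic graph by a Goodey graph -/

section Cover

variable {V : Type u} {G : SimpleGraph V} {R : RotationSystem G} {k : ℕ}

/-- A covering of a cubic map by the Goodey graph: the three directions at a vertex are sent to the
three darts at its image, and faces of size four lie at the corners of the patches only. -/
structure GoodeyCover (R : RotationSystem G) (k : ℕ) where
  /-- the map on vertices -/
  toFun : GoodeyVertex k → V
  /-- the map on directed edges -/
  dart : GoodeyVertex k → Fin 3 → G.Dart
  dart_fst : ∀ x r, (dart x r).fst = toFun x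
  dart_inj : ∀ x, Injective (dart x)
  dart_snd : ∀ r x y, GoodeyDir r x y → (dart x r).snd = toFun y
  period : ∀ x r, minimalPeriod R.facePerm (dart x r) = 4 ∨ minimalPeriod R.facePerm (dart x r) = 6
  /-- the corner of the patch next to a face of size four -/
  turn : (Fin 3 → Bool) → Fin 3 → Fin 3
  corner : ∀ x r, minimalPeriod R.facePerm (dart x r) = 4 → x.2.1 = Pi.single (turn x.1 r) k

namespace GoodeyCover

variable (f : GoodeyCover R k)

theorem exists_dart [Finite V] (hG : IsCubic G) (x : GoodeyVertex k) (d : G.Dart) (hd : d.fst = f.toFun x) :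
    ∃ r, f.dart x r = d := by
  have h1 : Set.range (f.dart x) = {d : G.Dart | d.fst = f.toFun x} := by
    refine Set.eq_of_subset_of_ncard_le ?_ ?_ (Set.toFinite _)
    · rintro _ ⟨r, rfl⟩
      exact f.dart_fst x r
    · rw [ncard_darts_fst, hG, ← Set.image_univ, Set.ncard_image_of_injective _ (f.dart_inj x),
        Set.ncard_univ, Nat.card_eq_fintype_card, Fintype.card_fin]
  exact (Set.ext_iff.1 h1 d).2 hd

theorem exists_lift [Finite V] (hG : IsCubic G) (x : GoodeyVertex k) (v : V) (h : G.Adj (f.toFun x) v) :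
    ∃ y, (goodeyGraph k).Adj x y ∧ f.toFun y = v := by
  obtain ⟨r, hr⟩ := f.exists_dart hG x ⟨(_, v), h⟩ rfl
  obtain ⟨y, hy⟩ := GoodeyDir.exists r x
  refine ⟨y, (goodeyGraph_adj_iff _ _).2 ⟨r, hy⟩, ?_⟩
  rw [← f.dart_snd r x y hy, hr]

theorem map_adj {x y : GoodeyVertex k} (h : (goodeyGraph k).Adj x y) :
    G.Adj (f.toFun x) (f.toFun y) := by
  obtain ⟨r, hr⟩ := (goodeyGraph_adj_iff _ _).1 h
  rw [← f.dart_fst x r, ← f.dart_snd r x y hr]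
  exact (f.dart x r).adj

theorem eq_of_adj {x y z : GoodeyVertex k} (hy : (goodeyGraph k).Adj x y)
    (hz : (goodeyGraph k).Adj x z) (h : f.toFun y = f.toFun z) : y = z := by
  obtain ⟨r, hr⟩ := (goodeyGraph_adj_iff _ _).1 hy
  obtain ⟨r', hr'⟩ := (goodeyGraph_adj_iff _ _).1 hz
  rw [← f.dart_snd r x y hr, ← f.dart_snd r' x z hr'] at h
  have : f.dart x r = f.dart x r' :=
    SimpleGraph.Dart.ext _ _ (Prod.ext ((f.dart_fst x r).trans (f.dart_fst x r').symm) h)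
  obtain rfl := f.dart_inj x this
  exact hr.unique hr'

theorem surjective [Finite V] (hG : IsCubic G) (hconn : G.Connected) : Surjective f.toFun := by
  intro v
  let x₀ : GoodeyVertex k := (fun _ => false, ⟨Pi.single 0 k, Or.inl (by simp)⟩)
  obtain ⟨p⟩ := hconn.preconnected (f.toFun x₀) v
  suffices ∀ {u v : V} (p : G.Walk u v) (x), f.toFun x = u → ∃ y, f.toFun y = v from this p x₀ rfl
  intro u v p
  induction p with
  | nil => exact fun x hx => ⟨x, hx⟩
  | cons h p ih =>
    rintro x rfl
    obtain ⟨y, -, hy⟩ := f.exists_lift hG x _ h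
    exact ih y hy

/-- Lifting the edge maps one fiber to the other, and the lift of the reversed edge is unique, so
this map is injective. -/
theorem ncard_fiber_le [Finite V] (hG : IsCubic G) {u v : V} (h : G.Adj u v) :
    (f.toFun ⁻¹' {u}).ncard ≤ (f.toFun ⁻¹' {v}).ncard := by
  have := fun x : f.toFun ⁻¹' {u} => f.exists_lift hG x v (by rw [x.2]; exact h)
  choose g hg hg' using this
  rw [← Nat.card_coe_set_eq, ← Nat.card_coe_set_eq]
  refine Nat.card_le_card_of_injective (fun x => (⟨g x, hg' x⟩ : f.toFun ⁻¹' {v})) ?_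
  intro x y hxy
  have h1 : g x = g y := congrArg Subtype.val hxy
  refine Subtype.ext (f.eq_of_adj (hg x).symm (h1 ▸ (hg y).symm) ?_)
  rw [x.2, y.2]

theorem ncard_fiber_eq [Finite V] (hG : IsCubic G) (hconn : G.Connected) (u v : V) :
    (f.toFun ⁻¹' {u}).ncard = (f.toFun ⁻¹' {v}).ncard := by
  obtain ⟨p⟩ := hconn.preconnected u v
  induction p with
  | nil => rfl
  | cons h p ih =>
    exact (le_antisymm (f.ncard_fiber_le hG h) (f.ncard_fiber_le hG h.symm)).trans ih

/-- By Euler's formula there are six faces of size four. -/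
theorem card_squareDarts [Finite V] (f : GoodeyCover R k) (hG : IsCubic G) (hR : R.IsPlane) :
    {d : G.Dart | minimalPeriod R.facePerm d = 4}.ncard = 24 := by
  have hsize : ∀ d, minimalPeriod R.facePerm d = 4 ∨ minimalPeriod R.facePerm d = 6 := by
    intro d
    obtain ⟨x, hx⟩ := f.surjective hG hR.1 d.fst
    obtain ⟨r, rfl⟩ := f.exists_dart hG x d hx.symm
    exact f.period x r
  have e := card_cycles_add_eq hG hR
  have e0 := card_eq_mul_card_cycles R.rot (minimalPeriod_rot (R := R) hG)
  have e1 := card_eq_mul_card_cycles (dartFlip G) minimalPeriod_dartFlip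
  let _ := Fintype.ofFinite (Cycles R.facePerm)
  have e2 := card_eq_sum_minimalPeriod R.facePerm
  classical
  have := Fintype.ofFinite G.Dart
  set P : Finset (Cycles R.facePerm) :=
    Finset.univ.filter fun c => minimalPeriod R.facePerm c.out = 4 with hP
  -- A square contributes 4 + 2 and a hexagon 6. With V = #D/3 and E = #D/2, Euler's formula then
  -- forces six squares.
  have e3 : Nat.card G.Dart + 2 * P.card = 6 * Nat.card (Cycles R.facePerm) := by
    rw [e2, Nat.card_eq_fintype_card, ← Finset.card_univ, Finset.card_eq_sum_ones,
      Finset.card_eq_sum_ones, hP, Finset.sum_filter, Finset.mul_sum, ← Finset.sum_add_distrib, Finset.mul_sum]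
    refine Finset.sum_congr rfl fun c _ => ?_
    rcases hsize c.out with h | h <;> simp [h]
  have e4 : {d : G.Dart | minimalPeriod R.facePerm d = 4}.ncard = 4 * P.card := by
    rw [Set.ncard_eq_toFinset_card', Set.toFinset_ofPred, Finset.card_eq_sum_card_fiberwise
      (f := fun d => (Quotient.mk _ d : Cycles R.facePerm)) (t := P), mul_comm]
    · refine Finset.sum_const_nat fun c hc => ?_
      rw [← Set.ncard_coe_finset]
      refine Eq.trans ?_ ((ncard_sameCycle R.facePerm c.out).trans (Finset.mem_filter.1 hc).2)
      congr 1
      ext d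
      simp only [Finset.coe_filter, Finset.mem_filter, Finset.mem_univ, true_and,
        Set.mem_ofPred_eq]
      constructor
      · rintro ⟨-, rfl⟩
        exact sameCycle_out R.facePerm d
      · intro h
        refine ⟨?_, ?_⟩
        · rw [minimalPeriod_sameCycle _ h]
          exact (Finset.mem_filter.1 hc).2
        · rw [← c.out_eq]
          exact Quotient.sound (Perm.SameCycle.symm h)
    · intro d hd
      simp only [Finset.coe_filter, Finset.mem_univ, true_and, Set.mem_ofPred_eq, hP] at hd ⊢
      rwa [minimalPeriod_sameCycle R.facePerm (sameCycle_out R.facePerm d).symm]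
  omega

/-- The base has 24 darts on squares. Upstairs, the corner condition admits at most one such dart
for each of the 8 patches and 3 directions. Two sheets would require 48. -/
theorem injective [Finite V] (f : GoodeyCover R k) (hG : IsCubic G) (hR : R.IsPlane) : Injective f.toFun := by
  classical
  have := Fintype.ofFinite (GoodeyVertex k)
  have := Fintype.ofFinite G.Dart
  set Q : Set G.Dart := {d | minimalPeriod R.facePerm d = 4} with hQ
  have hcard : Q.ncard = 24 := f.card_squareDarts hG hR
  set S : Set (GoodeyVertex k × Fin 3) := {y | f.dart y.1 y.2 ∈ Q} with hS
  have hS24 : S.ncard ≤ 24 := by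
    have h1 : S.ncard ≤ (Set.univ : Set ((Fin 3 → Bool) × Fin 3)).ncard := by
      refine Set.ncard_le_ncard_of_injOn (fun y => (y.1.1, y.2)) (fun _ _ => Set.mem_univ _) ?_
        (Set.toFinite _)
      rintro ⟨x, r⟩ hx ⟨y, r'⟩ hy h
      obtain ⟨h1, h2⟩ := Prod.ext_iff.1 h
      simp only at h1 h2
      subst h2
      have hx' := f.corner x r hx
      have hy' := f.corner y r hy
      exact Prod.ext (GoodeyVertex.ext h1 (hx'.trans (h1 ▸ hy'.symm))) rfl
    rwa [Set.ncard_univ, Nat.card_eq_fintype_card, Fintype.card_prod, Fintype.card_fun,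
      Fintype.card_bool, Fintype.card_fin] at h1
  have hfib : ∀ d : G.Dart, {y : GoodeyVertex k × Fin 3 | f.dart y.1 y.2 = d}.ncard =
      (f.toFun ⁻¹' {d.fst}).ncard := by
    intro d
    refine Set.ncard_congr (fun y _ => y.1) ?_ ?_ ?_
    · rintro ⟨x, r⟩ rfl
      exact (f.dart_fst x r).symm
    · rintro ⟨x, r⟩ ⟨y, r'⟩ h h' hxy
      simp only at hxy
      subst hxy
      exact Prod.ext rfl (f.dart_inj x (Eq.trans h (Eq.symm h')))
    · intro x hx
      obtain ⟨r, hr⟩ := f.exists_dart hG x d (Eq.symm hx)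
      exact ⟨(x, r), hr, rfl⟩
  intro x y hxy
  by_contra hne
  have h2 : ∀ v, 2 ≤ (f.toFun ⁻¹' {v}).ncard := by
    intro v
    rw [f.ncard_fiber_eq hG hR.1 v (f.toFun x), ← Set.ncard_pair hne]
    refine Set.ncard_le_ncard ?_ (Set.toFinite _)
    rintro z (rfl | rfl)
    · rfl
    · exact hxy.symm
  have h3 : 2 * Q.ncard ≤ S.ncard := by
    rw [Set.ncard_eq_toFinset_card' S, Set.ncard_eq_toFinset_card' Q,
      Finset.card_eq_sum_card_fiberwise (f := fun y : GoodeyVertex k × Fin 3 => f.dart y.1 y.2)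
        (t := Q.toFinset)
        (fun y hy => by simpa [hS] using hy), mul_comm, ← smul_eq_mul]
    refine Finset.card_nsmul_le_sum _ _ _ fun d hd => ?_
    refine (h2 d.fst).trans ?_
    rw [← hfib d, ← Set.ncard_coe_finset]
    refine Set.ncard_le_ncard ?_ (Set.toFinite _)
    rintro y hy
    have hy' : f.dart y.1 y.2 = d := hy
    have : d ∈ Q := by simpa using hd
    simp only [Finset.coe_filter, Set.mem_toFinset, Set.mem_ofPred_eq, hS]
    exact ⟨hy' ▸ this, hy'⟩
  omega

theorem nonempty_iso [Finite V] (f : GoodeyCover R k) (hG : IsCubic G) (hR : R.IsPlane) : Nonempty (G ≃g goodeyGraph k) := by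
  have hinj := f.injective hG hR
  refine ⟨SimpleGraph.Iso.symm ⟨Equiv.ofBijective f.toFun ⟨hinj, f.surjective hG hR.1⟩, ?_⟩⟩
  intro x y
  refine ⟨fun h => ?_, f.map_adj⟩
  obtain ⟨z, hz, hzy⟩ := f.exists_lift hG x _ h
  rwa [← hinj hzy]

end GoodeyCover

end Cover


open Function Equiv

/-! ### Development of the hexagonal lattice -/

section Development

variable {D : Type*}

/-- Cross a face of size six to the opposite edge: the dart parallel to `d` in the next face. -/
def lineStep (φ α : Perm D) (d : D) : D := φ (φ (φ (α d)))

/-- The dart parallel to `d` in the neighboring face in the next direction. -/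
def rowStep (φ α : Perm D) (d : D) : D := φ (φ (α (φ d)))

/-- The development of the lattice from the dart `d`. -/
def develop (φ α : Perm D) (d : D) (i j : ℕ) : D := (rowStep φ α)^[j] ((lineStep φ α)^[i] d)

variable {φ α : Perm D} {B : Set D}

theorem develop_succ_right (d : D) (i j : ℕ) :
    develop φ α d i (j + 1) = rowStep φ α (develop φ α d i j) :=
  iterate_succ_apply' _ _ _

theorem develop_succ_zero (d : D) (i : ℕ) :
    develop φ α d (i + 1) 0 = lineStep φ α (develop φ α d i 0) :=
  iterate_succ_apply' _ _ _

/-- `φ` conjugates `rowStep` into `lineStep`; thus column 0 of the development is the line that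
leaves the initial face through the next dart. -/
theorem apply_rowStep_iterate (x : D) (n : ℕ) :
    φ ((rowStep φ α)^[n] x) = (lineStep φ α)^[n] (φ x) := by
  induction n generalizing x with
  | zero => rfl
  | succ n ih => rw [iterate_succ_apply, ih, iterate_succ_apply]; rfl

/-- A cubic map: the product of the face permutation and the flip has order three. -/
structure IsCubicMap (φ α : Perm D) : Prop where
  flip_flip : ∀ d, α (α d) = d
  vertex : ∀ d, φ (α (φ (α (φ d)))) = α d

namespace IsCubicMap

variable (h : IsCubicMap φ α)
include h

theorem rowStep_eq_of_lineStep {x y : D} (hxy : lineStep φ α x = φ (φ (φ (φ y)))) :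
    rowStep φ α x = φ (α y) := by
  have h1 : α x = φ y := φ.injective (φ.injective (φ.injective hxy))
  have h2 : x = α (φ y) := by rw [← h1, h.flip_flip]
  rw [rowStep, h2, h.vertex]

/-- The two lattice directions commute by the vertex relation at two corners of the face of
`lineStep x`. Only that face has to be hexagonal, so a new row can be built before its face sizes
are known. -/
theorem lineStep_rowStep {x : D} (hx : φ (φ (φ (φ (φ (φ (lineStep φ α x)))))) = lineStep φ α x) :
    lineStep φ α (rowStep φ α x) = rowStep φ α (lineStep φ α x) := by
  have h1 : φ (φ (φ (φ (φ (φ (α x)))))) = α x :=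
    φ.injective (φ.injective (φ.injective hx))
  set y := φ (φ (φ (φ (α x)))) with hy
  have h2 : x = α (φ (φ y)) := by rw [h1, h.flip_flip]
  change φ (φ (φ (α (φ (φ (α (φ x))))))) = φ (φ (α y))
  rw [h2, h.vertex, h.vertex]

theorem turn_eq {x : D} (hx : φ (φ (φ (φ (φ (φ (lineStep φ α x)))))) = lineStep φ α x) :
    φ (α (φ x)) = α (φ (φ (lineStep φ α x))) := by
  have h1 : φ (φ (φ (lineStep φ α x))) = α x := φ.injective (φ.injective (φ.injective hx))
  have h2 : x = α (φ (φ (φ (lineStep φ α x)))) := by rw [h1, h.flip_flip]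
  conv_lhs => rw [h2]
  rw [h.vertex]

theorem rowStep_eq_of_eq {x y : D} (hxy : lineStep φ α x = φ (φ (φ (φ y)))) :
    rowStep φ α y = φ (φ x) := by
  have h1 : α x = φ y := φ.injective (φ.injective (φ.injective hxy))
  rw [rowStep, ← h1, h.flip_flip]

end IsCubicMap

theorem six_of_period {d : D} (h : minimalPeriod φ d = 6) :
    φ (φ (φ (φ (φ (φ d))))) = d := by
  have := iterate_minimalPeriod (f := φ) (x := d)
  rwa [h] at this

theorem four_of_period {d : D} (h : minimalPeriod φ d = 4) : φ (φ (φ (φ d))) = d := by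
  have := iterate_minimalPeriod (f := φ) (x := d)
  rwa [h] at this

theorem three_of_period {d : D} (h : minimalPeriod φ d = 3) : φ (φ (φ d)) = d := by
  have := iterate_minimalPeriod (f := φ) (x := d)
  rwa [h] at this

/-- A line system together with the smallest length `ℓ` of a line between two faces of size
four. -/
structure MinimalLine (φ α : Perm D) (B : Set D) (ℓ : ℕ) : Prop extends
    IsCubicMap φ α, LineSystem φ α B where
  pos : 0 < ℓ
  minimal : ∀ d, minimalPeriod φ d = 4 → ∀ i, 0 < i → i < ℓ →
    minimalPeriod φ ((lineStep φ α)^[i] d) ≠ 4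

/-- The line from `d` joins two faces of size four in the smallest number of steps. -/
structure IsSide (φ α : Perm D) (ℓ : ℕ) (d : D) : Prop where
  start : minimalPeriod φ d = 4
  finish : minimalPeriod φ ((lineStep φ α)^[ℓ] d) = 4

/-- `lineStep` is injective on a finite set, so its iterates return from a dart of a square to that
dart. Some length therefore occurs, and the least one is taken. -/
theorem exists_minimalLine [Finite D] (hφ : IsCubicMap φ α) (hB : LineSystem φ α B) {d₀ : D}
    (h : minimalPeriod φ d₀ = 4) : ∃ ℓ d, MinimalLine φ α B ℓ ∧ IsSide φ α ℓ d := by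
  classical
  have hinj : Injective (lineStep φ α) := fun x y hxy =>
    α.injective (φ.injective (φ.injective (φ.injective hxy)))
  have hex : ∃ n, 0 < n ∧ ∃ d, IsSide φ α n d :=
    ⟨minimalPeriod (lineStep φ α) d₀,
      minimalPeriod_pos_of_mem_periodicPts (hinj.mem_periodicPts d₀), d₀, h, by
        rwa [iterate_minimalPeriod]⟩
  obtain ⟨hpos, d, hd⟩ := Nat.find_spec hex
  exact ⟨Nat.find hex, d, ⟨hφ, hB, hpos, fun d hd i hi hlt h' =>
    Nat.find_min hex hlt ⟨hi, d, hd, h'⟩⟩, hd⟩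

theorem LineSystem.flip_mem_iff (h : LineSystem φ α B)
    (hα : ∀ d, α (α d) = d) (x : D) : α x ∈ B ↔ x ∈ B :=
  ⟨fun hx => by simpa [hα] using h.flip _ hx, h.flip x⟩

namespace MinimalLine

variable [Finite D] {ℓ : ℕ} (h : MinimalLine φ α B ℓ)
include h

/-- A line never enters a triangle, and by minimality it meets no square in between. So it runs
straight through hexagons. -/
theorem mem_of_lt {d : D} (hd : minimalPeriod φ d = 4) (i : ℕ) (hi : i < ℓ) :
    (lineStep φ α)^[i] d ∈ B ∧ (0 < i → minimalPeriod φ ((lineStep φ α)^[i] d) = 6) := by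
  induction i with
  | zero => exact ⟨h.sq d hd, fun h0 => absurd h0 (lt_irrefl _)⟩
  | succ i ih =>
    have h1 := h.flip _ (ih (by omega)).1
    have h2 := h.minimal d hd (i + 1) (by omega) hi
    rw [iterate_succ_apply'] at h2 ⊢
    set y := (lineStep φ α)^[i] d
    have h3 : minimalPeriod φ (lineStep φ α y) = minimalPeriod φ (α y) := by
      simp [lineStep, minimalPeriod_perm_apply]
    rw [h3] at h2 ⊢
    have h4 : minimalPeriod φ (α y) = 6 := by
      rcases h.period (α y) with h' | h' | h'
      · exact absurd h1 (h.tri _ h')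
      · exact absurd h' h2
      · exact h'
    exact ⟨h.opp _ h4 h1, fun _ => h4⟩

theorem notMem_of_hex {x : D} (hx : minimalPeriod φ x = 6) (hxB : x ∈ B) :
    φ x ∉ B ∧ φ (φ x) ∉ B := by
  refine ⟨h.adj x hx hxB, fun h2 => ?_⟩
  refine h.adj (φ (φ x)) ?_ h2 (h.opp x hx hxB)
  rw [minimalPeriod_perm_apply, minimalPeriod_perm_apply, hx]

/-- The properties of the `j`-th row of the triangle spanned by a side. -/
structure Row (φ α : Perm D) (B : Set D) (ℓ : ℕ) (d : D) (j : ℕ) : Prop where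
  step : ∀ i, i + j < ℓ → lineStep φ α (develop φ α d i j) = develop φ α d (i + 1) j
  inner : ∀ i, 0 < i → i + j < ℓ → minimalPeriod φ (develop φ α d i j) = 6 ∧
    φ (develop φ α d i j) ∉ B ∧ φ (φ (develop φ α d i j)) ∉ B
  last : ∀ i, i + j = ℓ → j < ℓ → develop φ α d i j =
    φ (φ (φ (φ ((lineStep φ α)^[j] ((lineStep φ α)^[ℓ] d)))))

/-- The fourth power of `φ` in `last` turns the direction of the third side into that of the rows on
a hexagon. On the square at the end of row 0 it is the identity. -/
theorem row_zero {d : D} (hd : IsSide φ α ℓ d) : Row φ α B ℓ d 0 := by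
  refine ⟨fun i _ => (develop_succ_zero d i).symm, fun i hi hlt => ?_, ?_⟩
  · obtain ⟨h1, h2⟩ := h.mem_of_lt hd.start i hlt
    exact ⟨h2 hi, h.notMem_of_hex (h2 hi) h1⟩
  · rintro i rfl -
    exact (four_of_period hd.finish).symm

/-- A square in row `j + 1` would send a line transversally into row `j`. A triangle acts as a
mirror for its row; the end of the row nearer to it is identified with an inner face, and the
boundary line through that end would again enter row `j`. -/
theorem hex_of_row {d : D} {j : ℕ} (hd : IsSide φ α ℓ d) (hj : Row φ α B ℓ d j)
    (hstep : ∀ i, i + (j + 1) < ℓ →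
      lineStep φ α (develop φ α d i (j + 1)) = develop φ α d (i + 1) (j + 1))
    (hlast : ∀ i, i + (j + 1) = ℓ → j + 1 < ℓ → develop φ α d i (j + 1) =
      φ (φ (φ (φ ((lineStep φ α)^[j + 1] ((lineStep φ α)^[ℓ] d))))))
    (i : ℕ) (hi : 0 < i) (hij : i + (j + 1) < ℓ) :
    minimalPeriod φ (develop φ α d i (j + 1)) = 6 := by
  induction i using Nat.strong_induction_on with
  | _ i ih =>
    by_contra hne
    have htri : minimalPeriod φ (develop φ α d i (j + 1)) = 3 := by
      refine (h.period _).resolve_right (not_or.2 ⟨fun h4 => ?_, hne⟩)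
      refine (hj.inner i hi (by omega)).2.1 ((h.toLineSystem.flip_mem_iff h.flip_flip _).1 (h.sq _ ?_))
      rw [develop_succ_right, rowStep, minimalPeriod_perm_apply, minimalPeriod_perm_apply] at h4
      exact h4
    -- Since `φ³` is trivial on the triangle, continuing straight means going back. The hexagons
    -- already found to the left are retraced, with the darts turned by `φ³`.
    have hreflect : ∀ s, s + 1 ≤ i → i + (s + 1) + (j + 1) ≤ ℓ →
        develop φ α d (i + (s + 1)) (j + 1) =
          φ (φ (φ (develop φ α d (i - (s + 1)) (j + 1)))) := by
      intro s
      induction s with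
      | zero =>
        intro h1 h2
        obtain ⟨m, rfl⟩ : ∃ m, i = m + 1 := ⟨i - 1, by omega⟩
        have e1 := hstep m (by omega)
        have e2 := three_of_period htri
        rw [← hstep (m + 1) hij]
        rw [← e2] at e1
        have e3 := φ.injective (φ.injective (φ.injective e1))
        rw [lineStep, ← e3, h.flip_flip]
        rfl
      | succ s ihs =>
        intro h1 h2
        obtain ⟨m, rfl⟩ : ∃ m, i = m + (s + 1 + 1) := ⟨i - (s + 1 + 1), by omega⟩
        have e1 := ihs (by omega) (by omega)
        have e2 := hstep (m + (s + 1 + 1) + (s + 1)) (by omega)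
        have e3 := hstep m (by omega)
        have e4 := six_of_period (ih (m + 1) (by omega) (by omega) (by omega))
        have e5 : m + (s + 1 + 1) - (s + 1) = m + 1 := by omega
        rw [e5] at e1
        rw [show m + (s + 1 + 1) - (s + 1 + 1) = m by omega,
          show m + (s + 1 + 1) + (s + 1 + 1) = m + (s + 1 + 1) + (s + 1) + 1 by omega, ← e2, e1,
          lineStep]
        rw [← e3] at e4 ⊢
        have e6 : φ (φ (φ (lineStep φ α (develop φ α d m (j + 1))))) =
            α (develop φ α d m (j + 1)) := φ.injective (φ.injective (φ.injective e4))
        rw [e6, h.flip_flip]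
    -- In the first case face `2 * i` of the row is face 0, which lies on the line from `φ d`. In
    -- the second case the last face of the row, on the third side, coincides with an earlier face.
    rcases le_or_gt (2 * i + (j + 1)) ℓ with hle | hgt
    · obtain ⟨s, rfl⟩ : ∃ s, i = s + 1 := ⟨i - 1, by omega⟩
      have e1 := hreflect s le_rfl (by omega)
      rw [develop_succ_right, rowStep, Nat.sub_self] at e1
      have e2 := φ.injective (φ.injective e1)
      have e3 : φ (develop φ α d 0 (j + 1)) ∈ B := by
        rw [develop, apply_rowStep_iterate]
        exact (h.mem_of_lt (by rw [iterate_zero, id, minimalPeriod_perm_apply, hd.start]) _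
          (by omega)).1
      rw [← e2, h.toLineSystem.flip_mem_iff h.flip_flip] at e3
      exact (hj.inner (s + 1 + (s + 1)) (by omega) (by omega)).2.1 e3
    · obtain ⟨s, hs⟩ : ∃ s, i + (s + 1) + (j + 1) = ℓ := ⟨ℓ - (j + 1) - i - 1, by omega⟩
      have e1 := hreflect s (by omega) hs.le
      rw [hlast _ hs (by omega)] at e1
      have e2 := φ.injective (φ.injective (φ.injective e1))
      set m := i - (s + 1) with hm
      rw [develop_succ_right, rowStep] at e2
      have e3 := φ.injective e2
      have e4 := hj.step m (by omega)
      have e5 := hj.inner (m + 1) (by omega) (by omega)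
      rw [← e4] at e5
      rw [h.turn_eq (six_of_period e5.1)] at e3
      have e6 := (h.mem_of_lt hd.finish (j + 1) (by omega)).1
      rw [e3, h.toLineSystem.flip_mem_iff h.flip_flip] at e6
      exact e5.2.2 e6

/-- A transversal line through a hexagon of the new row leaves it through the opposite edge, which
is an edge of a face of row `j`, where it is excluded. -/
theorem row_succ {d : D} {j : ℕ} (hd : IsSide φ α ℓ d) (hj : Row φ α B ℓ d j) :
    Row φ α B ℓ d (j + 1) := by
  have hstep : ∀ i, i + (j + 1) < ℓ →
      lineStep φ α (develop φ α d i (j + 1)) = develop φ α d (i + 1) (j + 1) := by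
    intro i hi
    have e1 := hj.step i (by omega)
    have e2 := six_of_period (hj.inner (i + 1) (by omega) (by omega)).1
    rw [← e1] at e2
    rw [develop_succ_right, develop_succ_right, h.lineStep_rowStep e2, e1]
  have hlast : ∀ i, i + (j + 1) = ℓ → j + 1 < ℓ → develop φ α d i (j + 1) =
      φ (φ (φ (φ ((lineStep φ α)^[j + 1] ((lineStep φ α)^[ℓ] d))))) := by
    intro i hi hlt
    have e1 := hj.step i (by omega)
    rw [hj.last (i + 1) (by omega) (by omega)] at e1
    have e2 := six_of_period ((h.mem_of_lt hd.finish (j + 1) hlt).2 (by omega))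
    rw [iterate_succ_apply'] at e2 ⊢
    rw [develop_succ_right, h.rowStep_eq_of_lineStep e1]
    exact φ.injective (φ.injective (e2.symm))
  have hhex := h.hex_of_row hd hj hstep hlast
  refine ⟨hstep, fun i hi hlt => ⟨hhex i hi hlt, fun hmem => ?_, fun hmem => ?_⟩, hlast⟩
  · have e1 := hhex i hi hlt
    have e2 := h.opp _ ((minimalPeriod_perm_apply _ _).trans e1) hmem
    rw [develop_succ_right, rowStep] at e1 e2
    rw [six_of_period (by simpa [minimalPeriod_perm_apply] using e1), h.toLineSystem.flip_mem_iff h.flip_flip] at e2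
    exact (hj.inner i hi (by omega)).2.1 e2
  · have e1 := hhex i hi hlt
    have e2 := h.opp _ (((minimalPeriod_perm_apply _ _).trans
      (minimalPeriod_perm_apply _ _)).trans e1) hmem
    rw [develop_succ_right, rowStep] at e1 e2
    rw [six_of_period (d := φ (α (φ (develop φ α d i j))))
      (by simpa [minimalPeriod_perm_apply] using e1)] at e2
    have e4 := hj.step i (by omega)
    have e5 := hj.inner (i + 1) (by omega) (by omega)
    rw [← e4] at e5
    rw [h.turn_eq (six_of_period e5.1), h.toLineSystem.flip_mem_iff h.flip_flip] at e2
    exact e5.2.2 e2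

theorem row {d : D} (hd : IsSide φ α ℓ d) (j : ℕ) : Row φ α B ℓ d j := by
  induction j with
  | zero => exact h.row_zero hd
  | succ j ih => exact h.row_succ hd ih

end MinimalLine

end Development


open Function Equiv RotationSystem

/-! ### Corners of the triangle and the octahedral relations. -/

section Corners

variable {D : Type*} {φ α : Perm D} {B : Set D}

namespace MinimalLine

variable [Finite D] {ℓ : ℕ} (h : MinimalLine φ α B ℓ)
include h

/-- The left side and the third side enter the last face through consecutive edges. Triangles meet
no line and hexagons only a pair of opposite edges, so this face is a square. -/
theorem apex {d : D} (hd : IsSide φ α ℓ d) :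
    φ (develop φ α d 0 ℓ) = (lineStep φ α)^[ℓ] (φ d) ∧
    φ (φ (develop φ α d 0 ℓ)) = (lineStep φ α)^[ℓ] ((lineStep φ α)^[ℓ] d) ∧
    minimalPeriod φ (develop φ α d 0 ℓ) = 4 := by
  obtain ⟨j, hj⟩ : ∃ j, ℓ = j + 1 := ⟨ℓ - 1, by have := h.pos; omega⟩
  have r := h.row hd j
  have e1 := r.step 0 (by omega)
  rw [r.last (0 + 1) (by omega) (by omega)] at e1
  have e2 := h.rowStep_eq_of_lineStep e1
  set E := (lineStep φ α)^[j] ((lineStep φ α)^[ℓ] d) with hE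
  have e3 : develop φ α d 0 ℓ = φ (α E) := by
    rw [← e2, ← develop_succ_right, hj]
  have e4 : φ (develop φ α d 0 ℓ) = (lineStep φ α)^[ℓ] (φ d) := apply_rowStep_iterate d ℓ
  refine ⟨e4, ?_, ?_⟩
  · rw [e3]
    conv_rhs => enter [2]; rw [hj]
    rw [iterate_succ_apply', ← hE]
    rfl
  · have hφd : minimalPeriod φ (φ d) = 4 := (minimalPeriod_perm_apply _ _).trans hd.start
    have m1 := (h.mem_of_lt hφd j (by omega)).1
    have m2 := (h.mem_of_lt hd.finish j (by omega)).1
    rw [← h.toLineSystem.flip_mem_iff h.flip_flip] at m1 m2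
    set u := (lineStep φ α)^[j] (φ d) with hu
    have e5 : φ (φ (φ (α u))) = φ (φ (α E)) := by
      rw [← e3, e4]
      conv_rhs => enter [2]; rw [hj]
      rw [iterate_succ_apply', ← hu]
      rfl
    have e6 : φ (α u) = α E := φ.injective (φ.injective e5)
    rw [← e6] at m2
    have e7 : minimalPeriod φ (develop φ α d 0 ℓ) = minimalPeriod φ (α u) := by
      rw [e3, ← e6, minimalPeriod_perm_apply, minimalPeriod_perm_apply]
    rw [e7]
    rcases h.period (α u) with h' | h' | h'
    · exact absurd m1 (h.tri _ h')
    · exact h'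
    · exact absurd m2 (h.adj _ h' m1)

theorem isSide_turn {d : D} (hd : IsSide φ α ℓ d) : IsSide φ α ℓ (φ d) := by
  obtain ⟨h1, -, h3⟩ := h.apex hd
  refine ⟨(minimalPeriod_perm_apply _ _).trans hd.start, ?_⟩
  rw [← h1, minimalPeriod_perm_apply, h3]

theorem isSide_next {d : D} (hd : IsSide φ α ℓ d) : IsSide φ α ℓ ((lineStep φ α)^[ℓ] d) := by
  obtain ⟨-, h2, h3⟩ := h.apex hd
  refine ⟨hd.finish, ?_⟩
  rw [← h2, minimalPeriod_perm_apply, minimalPeriod_perm_apply, h3]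

theorem turn_next_turn {d : D} (hd : IsSide φ α ℓ d) :
    φ ((lineStep φ α)^[ℓ] (φ d)) = (lineStep φ α)^[ℓ] ((lineStep φ α)^[ℓ] d) := by
  obtain ⟨h1, h2, -⟩ := h.apex hd
  rw [← h1, h2]

/-- Turning at the end of a side gives the reverse of its last dart before the end. The same line is
then run backwards to the initial square. -/
theorem turn_next_turn_next {d : D} (hd : IsSide φ α ℓ d) :
    φ ((lineStep φ α)^[ℓ] (φ ((lineStep φ α)^[ℓ] d))) = d := by
  obtain ⟨j, hj⟩ : ∃ j, ℓ = j + 1 := ⟨ℓ - 1, by have := h.pos; omega⟩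
  have e1 : φ ((lineStep φ α)^[ℓ] d) = α ((lineStep φ α)^[j] d) := by
    have h4 := four_of_period hd.finish
    rw [hj, iterate_succ_apply'] at h4 ⊢
    exact φ.injective (φ.injective (φ.injective h4))
  have e2 : ∀ i, i ≤ j → (lineStep φ α)^[i] (α ((lineStep φ α)^[j] d)) =
      α ((lineStep φ α)^[j - i] d) := by
    intro i
    induction i with
    | zero => exact fun _ => rfl
    | succ i ih =>
      intro hi
      obtain ⟨m, rfl⟩ : ∃ m, j = m + (i + 1) := ⟨j - (i + 1), by omega⟩
      rw [iterate_succ_apply', ih (by omega), show m + (i + 1) - i = m + 1 by omega,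
        show m + (i + 1) - (i + 1) = m by omega]
      have h6 := six_of_period ((h.mem_of_lt hd.start (m + 1) (by omega)).2 (by omega))
      rw [lineStep, h.flip_flip]
      rw [iterate_succ_apply'] at h6 ⊢
      exact φ.injective (φ.injective (φ.injective h6))
  rw [e1, hj, iterate_succ_apply', e2 j le_rfl, Nat.sub_self, iterate_zero, id, lineStep,
    h.flip_flip, four_of_period hd.start]

/-- With S the passage along a side, this completes the relations φ⁴ = S³ = (φS)² = 1 of the
octahedral rotation group: squares are its vertices, sides its edges, developed triangles its faces.
-/
theorem next_next_next {d : D} (hd : IsSide φ α ℓ d) :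
    (lineStep φ α)^[ℓ] ((lineStep φ α)^[ℓ] ((lineStep φ α)^[ℓ] d)) = d := by
  rw [← h.turn_next_turn (h.isSide_next hd), h.turn_next_turn_next hd]

theorem isSide_turn_symm {d : D} (hd : IsSide φ α ℓ d) : IsSide φ α ℓ (φ.symm d) := by
  have := h.isSide_turn (h.isSide_turn (h.isSide_turn hd))
  rwa [show φ (φ (φ d)) = φ.symm d by
    rw [Equiv.eq_symm_apply, four_of_period hd.start]] at this

theorem period_develop {d : D} (hd : IsSide φ α ℓ d) {i j : ℕ} (hij : i + j ≤ ℓ) :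
    minimalPeriod φ (develop φ α d i j) = 6 ∨ minimalPeriod φ (develop φ α d i j) = 4 ∧
      ((i = 0 ∧ j = 0) ∨ (i = ℓ ∧ j = 0) ∨ (i = 0 ∧ j = ℓ)) := by
  rcases Nat.eq_zero_or_pos i with rfl | hi
  · rcases Nat.eq_zero_or_pos j with rfl | hj
    · exact Or.inr ⟨hd.start, Or.inl ⟨rfl, rfl⟩⟩
    · rcases Nat.lt_or_ge j ℓ with hlt | hge
      · left
        rw [← minimalPeriod_perm_apply, develop, apply_rowStep_iterate]
        exact (h.mem_of_lt ((minimalPeriod_perm_apply _ _).trans hd.start) j hlt).2 hj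
      · obtain rfl : j = ℓ := by omega
        exact Or.inr ⟨(h.apex hd).2.2, Or.inr (Or.inr ⟨rfl, rfl⟩)⟩
  · rcases Nat.lt_or_ge (i + j) ℓ with hlt | hge
    · exact Or.inl ((h.row hd j).inner i hi hlt).1
    · have hij' : i + j = ℓ := by omega
      rcases Nat.eq_zero_or_pos j with rfl | hj
      · obtain rfl : i = ℓ := by omega
        exact Or.inr ⟨hd.finish, Or.inr (Or.inl ⟨rfl, rfl⟩)⟩
      · left
        rw [(h.row hd j).last i hij' (by omega)]
        simp only [minimalPeriod_perm_apply]
        exact (h.mem_of_lt hd.finish j (by omega)).2 hj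

theorem six_develop {d : D} (hd : IsSide φ α ℓ d) {i j : ℕ} (hij : i + j < ℓ) (hi : 0 < i) :
    φ (φ (φ (φ (φ (φ (develop φ α d i j)))))) = develop φ α d i j :=
  six_of_period ((h.row hd j).inner i hi hij).1

/-- The same triangle seen from its next corner, by induction on the distance `l` from the third
side. The coordinates are permuted cyclically, and `φ⁴` adjusts the direction. -/
theorem develop_rotate {d : D} (hd : IsSide φ α ℓ d) (i j l : ℕ) (hi : 0 < i)
    (hs : i + j + l = ℓ) :
    develop φ α d i j = φ (φ (φ (φ (develop φ α ((lineStep φ α)^[ℓ] d) j l)))) := by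
  induction l generalizing i with
  | zero => exact (h.row hd j).last i hs (by omega)
  | succ l ih =>
    have e1 := ih (i + 1) (by omega) (by omega)
    rw [← (h.row hd j).step i (by omega)] at e1
    rw [develop_succ_right, h.rowStep_eq_of_eq e1, h.six_develop hd (by omega) hi]

theorem turn_develop {d : D} (hd : IsSide φ α ℓ d) {i j : ℕ} (hij : i + 1 + j < ℓ) :
    φ (α (φ (develop φ α d i j))) = α (φ (φ (develop φ α d (i + 1) j))) ∧
    φ (φ (φ (develop φ α d (i + 1) j))) = α (develop φ α d i j) := by
  have e1 := h.six_develop hd hij (by omega)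
  rw [← (h.row hd j).step i (by omega)] at e1 ⊢
  exact ⟨h.turn_eq e1, φ.injective (φ.injective (φ.injective e1))⟩

end MinimalLine

end Corners

/-! ### Triangular patches -/

section Patch

variable {V : Type u} {G : SimpleGraph V}

/-- The three darts at an upward triangle whose lower left corner is the face of `F`. -/
def upDart (R : RotationSystem G) (F : G.Dart) : Fin 3 → G.Dart :=
  ![R.facePerm F, dartFlip G F, R.facePerm (dartFlip G (R.facePerm F))]

/-- The three darts at a downward triangle whose lower corner is the face of `F`. -/
def downDart (R : RotationSystem G) (F : G.Dart) : Fin 3 → G.Dart :=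
  ![dartFlip G (R.facePerm F), R.facePerm (dartFlip G (R.facePerm (R.facePerm F))),
    R.facePerm (R.facePerm F)]

/-- The vertices of the patch developed from the dart `d`. -/
def patchVertex (R : RotationSystem G) (k : ℕ) (d : G.Dart) (t : Fin 3 → ℕ) : V :=
  if t 0 + t 1 + t 2 = k then (develop R.facePerm (dartFlip G) d (t 0) (t 1)).snd
  else (R.facePerm (develop R.facePerm (dartFlip G) d (t 0 + 1) (t 1))).snd

/-- The darts of the patch developed from the dart `d`. -/
def patchDart (R : RotationSystem G) (k : ℕ) (d : G.Dart) (t : Fin 3 → ℕ) : Fin 3 → G.Dart :=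
  if t 0 + t 1 + t 2 = k then upDart R (develop R.facePerm (dartFlip G) d (t 0) (t 1))
  else downDart R (develop R.facePerm (dartFlip G) d (t 0 + 1) (t 1))

variable {R : RotationSystem G} {k : ℕ}

theorem facePerm_dartFlip (d : G.Dart) : R.facePerm (dartFlip G d) = R.rot d := by
  rw [facePerm_apply, dartFlip_apply, SimpleGraph.Dart.symm_symm]

theorem isCubicMap [Finite V] (hG : IsCubic G) : IsCubicMap R.facePerm (dartFlip G) := by
  refine ⟨dartFlip_dartFlip, fun d => ?_⟩
  rw [facePerm_dartFlip, facePerm_dartFlip]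
  exact rot_rot_rot hG (dartFlip G d)

theorem patchDart_fst (d : G.Dart) (t : Fin 3 → ℕ) (r : Fin 3) :
    (patchDart R k d t r).fst = patchVertex R k d t := by
  unfold patchDart patchVertex
  split_ifs
  · fin_cases r
    · exact facePerm_fst R _
    · rfl
    · exact (facePerm_fst R _).trans (facePerm_fst R _)
  · fin_cases r
    · rfl
    · exact (facePerm_fst R _).trans (facePerm_fst R _)
    · exact facePerm_fst R _

theorem patchDart_injective [Finite V] (hG : IsCubic G) (d : G.Dart) (t : Fin 3 → ℕ) :
    Injective (patchDart R k d t) := by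
  have key : ∀ (w : G.Dart), Injective ![R.rot w, w, R.rot (R.rot w)] ∧
      Injective ![w, R.rot (R.rot w), R.rot w] := by
    intro w
    have h1 := rot_ne (R := R) hG w
    have h2 := rot_rot_ne (R := R) hG w
    have h3 := rot_ne (R := R) hG (R.rot w)
    constructor <;> intro r s hrs <;> fin_cases r <;> fin_cases s <;>
      first | rfl | exact absurd hrs (by assumption) | exact absurd hrs.symm (by assumption)
  unfold patchDart
  split_ifs
  · have := (key (dartFlip G (develop R.facePerm (dartFlip G) d (t 0) (t 1)))).1
    unfold upDart
    rw [facePerm_dartFlip]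
    exact this
  · have := (key (dartFlip G (R.facePerm
      (develop R.facePerm (dartFlip G) d (t 0 + 1) (t 1))))).2
    unfold downDart
    rw [facePerm_dartFlip]
    exact this

variable [Finite V] {B : Set G.Dart} (h : MinimalLine R.facePerm (dartFlip G) B (k + 1))
include h

/-- At an upward triangle `t`, the darts 0, 1, 2 bound the faces at (t₀, t₁), (t₀ + 1, t₁), (t₀, t₁
+ 1). Such a face can be a corner only if coordinate 2, 0 or 1, respectively, equals `k`. Downward
triangles touch no corner. -/
theorem patchDart_period {d : G.Dart} (hd : IsSide R.facePerm (dartFlip G) (k + 1) d)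
    (t : Fin 3 → ℕ) (ht : t 0 + t 1 + t 2 = k ∨ t 0 + t 1 + t 2 + 1 = k) (r : Fin 3) :
    minimalPeriod R.facePerm (patchDart R k d t r) = 6 ∨
      minimalPeriod R.facePerm (patchDart R k d t r) = 4 ∧ t = Pi.single (r + 2) k := by
  set α := dartFlip G
  set φ := R.facePerm
  have hrow : ∀ i j, rowStep φ α (develop φ α d i j) = develop φ α d i (j + 1) := fun i j =>
    (develop_succ_right _ _ _).symm
  have hfun : ∀ r : Fin 3, (t 0 = (Pi.single r k : Fin 3 → ℕ) 0 ∧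
      t 1 = (Pi.single r k : Fin 3 → ℕ) 1 ∧ t 2 = (Pi.single r k : Fin 3 → ℕ) 2) →
      t = Pi.single r k := by
    rintro r ⟨h0, h1, h2⟩
    funext j
    fin_cases j <;> assumption
  rcases ht with ht | ht
  · rw [patchDart, if_pos ht]
    fin_cases r
    · have e := h.period_develop hd (i := t 0) (j := t 1) (by omega)
      rw [← minimalPeriod_perm_apply] at e
      refine e.imp_right fun e => ⟨e.1, hfun _ ?_⟩
      simp
      omega
    · have e := h.period_develop hd (i := t 0 + 1) (j := t 1) (by omega)
      rw [← (h.row hd (t 1)).step (t 0) (by omega), lineStep, minimalPeriod_perm_apply,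
        minimalPeriod_perm_apply, minimalPeriod_perm_apply] at e
      refine e.imp_right fun e => ⟨e.1, hfun _ ?_⟩
      simp
      omega
    · have e := h.period_develop hd (i := t 0) (j := t 1 + 1) (by omega)
      rw [← hrow, rowStep, minimalPeriod_perm_apply] at e
      refine e.imp_right fun e => ⟨e.1, hfun _ ?_⟩
      simp
      omega
  · rw [patchDart, if_neg (by omega)]
    left
    fin_cases r
    · have e := h.period_develop hd (i := t 0 + 1) (j := t 1 + 1) (by omega)
      rw [← hrow, rowStep, minimalPeriod_perm_apply, minimalPeriod_perm_apply] at e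
      exact e.resolve_right (by omega)
    · have e := h.period_develop hd (i := t 0) (j := t 1 + 1) (by omega)
      have e' := h.turn_develop hd (i := t 0) (j := t 1) (by omega)
      rw [← hrow, rowStep, e'.1] at e
      exact e.resolve_right (by omega)
    · have e := h.period_develop hd (i := t 0 + 1) (j := t 1) (by omega)
      rw [← minimalPeriod_perm_apply, ← minimalPeriod_perm_apply] at e
      exact e.resolve_right (by omega)

theorem patchDart_inner {d : G.Dart} (hd : IsSide R.facePerm (dartFlip G) (k + 1) d)
    (t : Fin 3 → ℕ) (ht : t 0 + t 1 + t 2 + 1 = k) (r : Fin 3) :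
    (patchDart R k d t r).snd = patchVertex R k d (t + Pi.single r 1) ∧
      (patchDart R k d (t + Pi.single r 1) r).snd = patchVertex R k d t := by
  have e := h.turn_develop hd (i := t 0) (j := t 1) (by omega)
  have hs := sum_add_single t r
  have hup := hs.trans ht
  unfold patchDart patchVertex
  rw [if_neg (show t 0 + t 1 + t 2 ≠ k by omega), if_neg (show t 0 + t 1 + t 2 ≠ k by omega),
    if_pos hup, if_pos hup]
  clear hs hup
  have hf : ∀ x : G.Dart, (R.facePerm (dartFlip G x)).fst = x.fst := fun x => facePerm_fst R _
  fin_cases r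
  · simp [upDart, downDart, dartFlip_apply, facePerm_fst]
  · have e2 : R.facePerm (dartFlip G (R.facePerm (R.facePerm
        (develop R.facePerm (dartFlip G) d (t 0 + 1) (t 1))))) =
        develop R.facePerm (dartFlip G) d (t 0) (t 1 + 1) := by
      rw [← e.1, develop_succ_right, rowStep]
    refine ⟨?_, ?_⟩
    · simp [downDart, e2]
    · simp only [upDart, Fin.mk_one, Matrix.cons_val_one, Matrix.cons_val_zero, Pi.add_apply]
      simp only [Pi.single_eq_same, ne_eq, zero_ne_one, not_false_eq_true, Pi.single_eq_of_ne,
        add_zero, ← e2]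
      change (R.facePerm (dartFlip G _)).fst = _
      rw [hf, facePerm_fst]
  · refine ⟨?_, ?_⟩
    · simp only [downDart, Fin.reduceFinMk, Matrix.cons_val, Pi.add_apply]
      rw [← facePerm_fst R, e.2]
      simp [dartFlip_apply]
    · have e3 : (R.facePerm (dartFlip G (R.facePerm
          (develop R.facePerm (dartFlip G) d (t 0) (t 1))))).snd =
          (R.facePerm (develop R.facePerm (dartFlip G) d (t 0 + 1) (t 1))).snd := by
        rw [e.1]
        exact facePerm_fst R _
      simp [upDart, e3]

end Patch


open Function Equiv RotationSystem

/-! ### Gluing the patches -/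

section Glue

variable {V : Type u} {G : SimpleGraph V}

/-- The corner of the patch across the side opposite to `d`. -/
def acrossDart (R : RotationSystem G) (k : ℕ) (d : G.Dart) : G.Dart :=
  (lineStep R.facePerm (dartFlip G))^[k + 1]
    (R.facePerm.symm ((lineStep R.facePerm (dartFlip G))^[k + 1] d))

/-- The dart from which the neighboring patch in direction `r` is developed. -/
def outerDart (R : RotationSystem G) (k : ℕ) (d : G.Dart) : Fin 3 → G.Dart :=
  ![R.facePerm d, R.facePerm.symm d, acrossDart R k d]

variable {R : RotationSystem G} {k : ℕ} [Finite V] {B : Set G.Dart}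
  (h : MinimalLine R.facePerm (dartFlip G) B (k + 1))
include h

theorem patch_rotate {d : G.Dart} (hd : IsSide R.facePerm (dartFlip G) (k + 1) d) (i j l : ℕ)
    (hs : i + j + l = k) :
    (develop R.facePerm (dartFlip G) d i j).snd = (develop R.facePerm (dartFlip G)
      ((lineStep R.facePerm (dartFlip G))^[k + 1] d) j l).snd ∧
    R.facePerm (dartFlip G (R.facePerm (develop R.facePerm (dartFlip G) d i j))) =
      dartFlip G (develop R.facePerm (dartFlip G)
        ((lineStep R.facePerm (dartFlip G))^[k + 1] d) j l) := by
  -- Coordinates of faces sum to `k + 1` on the third side, those of upward triangles to `k`; hence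
  -- the shift of `i`.
  have e1 := h.develop_rotate hd (i + 1) j l (by omega) (by omega)
  rw [← (h.row hd j).step i (by omega)] at e1
  set y := develop R.facePerm (dartFlip G) ((lineStep R.facePerm (dartFlip G))^[k + 1] d) j l
  set F := develop R.facePerm (dartFlip G) d i j
  have e2 : dartFlip G F = R.facePerm y :=
    R.facePerm.injective (R.facePerm.injective (R.facePerm.injective e1))
  refine ⟨?_, ?_⟩
  · rw [← facePerm_fst R y, ← e2]
    rfl
  · have e3 : F = dartFlip G (R.facePerm y) := by rw [← e2, dartFlip_dartFlip]
    rw [e3, h.vertex]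

omit h [Finite V] in
theorem flip_develop_snd (d : G.Dart) (i : ℕ) :
    (dartFlip G (develop R.facePerm (dartFlip G) d i 0)).snd =
      (develop R.facePerm (dartFlip G) (R.facePerm.symm d) 0 i).snd := by
  have e : develop R.facePerm (dartFlip G) d i 0 =
      R.facePerm (develop R.facePerm (dartFlip G) (R.facePerm.symm d) 0 i) := by
    conv_lhs => rw [← R.facePerm.apply_symm_apply d]
    exact (apply_rowStep_iterate _ _).symm
  rw [e, ← facePerm_fst R (develop _ _ _ 0 i)]
  rfl

/-- Patches on the two sides of a line read its positions with the first two coordinates exchanged.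
The side opposite to the initial corner is handled by rotating the patch to make it the base,
crossing it, and rotating the new patch. -/
theorem patchDart_outer {d : G.Dart} (hd : IsSide R.facePerm (dartFlip G) (k + 1) d)
    (t : Fin 3 → ℕ) (ht : t 0 + t 1 + t 2 = k) (r : Fin 3) (hr : t r = 0) :
    (patchDart R k d t r).snd = patchVertex R k (outerDart R k d r) (t ∘ swap 0 1) := by
  have ht' : (t ∘ swap 0 1) 0 + (t ∘ swap 0 1) 1 + (t ∘ swap 0 1) 2 = k := by
    have : (swap 0 1 : Perm (Fin 3)) 2 = 2 := by decide
    simp only [comp_apply, swap_apply_left, swap_apply_right, this]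
    omega
  rw [patchDart, patchVertex, if_pos ht, if_pos ht']
  simp only [comp_apply, swap_apply_left, swap_apply_right]
  fin_cases r
  · simp only [Fin.zero_eta] at hr
    rw [hr]
    exact congrArg (fun d : G.Dart => d.snd) (apply_rowStep_iterate d (t 1))
  · simp only [Fin.mk_one] at hr
    rw [hr]
    exact flip_develop_snd d (t 0)
  · simp only [Fin.reduceFinMk] at hr
    have e1 := (patch_rotate h hd (t 0) (t 1) 0 (by omega)).2
    have e2 := (patch_rotate h (h.isSide_turn_symm (h.isSide_next hd)) 0 (t 1) (t 0)
      (by omega)).1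
    change (R.facePerm (dartFlip G (R.facePerm
      (develop R.facePerm (dartFlip G) d (t 0) (t 1))))).snd = _
    rw [e1, flip_develop_snd, e2]
    rfl

omit h [Finite V] in
theorem symm_symm_eq {x : G.Dart} (hx : minimalPeriod R.facePerm x = 4) :
    R.facePerm.symm (R.facePerm.symm x) = R.facePerm (R.facePerm x) := by
  rw [Equiv.symm_apply_eq, Equiv.symm_apply_eq, four_of_period hx]

theorem acrossDart_acrossDart {x : G.Dart} (hx : IsSide R.facePerm (dartFlip G) (k + 1) x) :
    acrossDart R k (acrossDart R k x) = x := by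
  have hy := h.isSide_turn_symm (h.isSide_next hx)
  unfold acrossDart
  rw [← h.turn_next_turn hy, Equiv.apply_symm_apply, Equiv.symm_apply_apply, h.next_next_next hx]

/-- In the octahedral group the word S φ⁻¹ S is an involution that inverts φ; it leads to the
antipodal square. -/
theorem acrossDart_facePerm {x : G.Dart} (hx : IsSide R.facePerm (dartFlip G) (k + 1) x) :
    acrossDart R k (R.facePerm x) = R.facePerm.symm (acrossDart R k x) := by
  have hy := h.isSide_turn_symm (h.isSide_next hx)
  have hz := h.isSide_next (h.isSide_next hx)
  have e1 : R.facePerm.symm (acrossDart R k x) = (lineStep R.facePerm (dartFlip G))^[k + 1]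
      (R.facePerm ((lineStep R.facePerm (dartFlip G))^[k + 1] (acrossDart R k x))) := by
    rw [Equiv.symm_apply_eq]
    exact (h.turn_next_turn_next (h.isSide_next hy)).symm
  have e2 : (lineStep R.facePerm (dartFlip G))^[k + 1] (R.facePerm x) = R.facePerm.symm
      ((lineStep R.facePerm (dartFlip G))^[k + 1]
        ((lineStep R.facePerm (dartFlip G))^[k + 1] x)) := by
    rw [Equiv.eq_symm_apply, h.turn_next_turn hx]
  rw [e1]
  unfold acrossDart
  rw [e2, ← h.turn_next_turn hy, Equiv.apply_symm_apply, symm_symm_eq hz.start]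

theorem acrossDart_symm {x : G.Dart} (hx : IsSide R.facePerm (dartFlip G) (k + 1) x) :
    acrossDart R k (R.facePerm.symm x) = R.facePerm (acrossDart R k x) := by
  have := acrossDart_facePerm h (h.isSide_turn_symm hx)
  rw [Equiv.apply_symm_apply] at this
  rw [this, Equiv.apply_symm_apply]

theorem isSide_acrossDart {x : G.Dart} (hx : IsSide R.facePerm (dartFlip G) (k + 1) x) :
    IsSide R.facePerm (dartFlip G) (k + 1) (acrossDart R k x) :=
  h.isSide_next (h.isSide_turn_symm (h.isSide_next hx))

/-- The dart reached from `x` by the turns prescribed by two bits. -/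
def turnBits (R : RotationSystem G) (a b : Bool) (x : G.Dart) : G.Dart :=
  match a, b with
  | false, false => x
  | true, false => R.facePerm x
  | false, true => R.facePerm.symm x
  | true, true => R.facePerm (R.facePerm x)

/-- The corners from which the eight patches are developed. -/
def cornerDart (R : RotationSystem G) (k : ℕ) (d : G.Dart) (ε : Fin 3 → Bool) : G.Dart :=
  match ε 2 with
  | false => turnBits R (ε 0) (ε 1) d
  | true => turnBits R (ε 1) (ε 0) (acrossDart R k d)

/-- The patches of odd sign are reflected. -/
def patchSwap (ε : Fin 3 → Bool) : Perm (Fin 3) :=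
  if (ε 0 ^^ ε 1 ^^ ε 2) then swap 0 1 else 1

theorem isSide_turnBits {d : G.Dart} (hd : IsSide R.facePerm (dartFlip G) (k + 1) d) (a b : Bool) :
    IsSide R.facePerm (dartFlip G) (k + 1) (turnBits R a b d) := by
  cases a <;> cases b
  · exact hd
  · exact h.isSide_turn_symm hd
  · exact h.isSide_turn hd
  · exact h.isSide_turn (h.isSide_turn hd)

theorem isSide_cornerDart {d : G.Dart} (hd : IsSide R.facePerm (dartFlip G) (k + 1) d)
    (ε : Fin 3 → Bool) : IsSide R.facePerm (dartFlip G) (k + 1) (cornerDart R k d ε) := by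
  unfold cornerDart
  split
  · exact isSide_turnBits h hd _ _
  · exact isSide_turnBits h (isSide_acrossDart h hd) _ _

/-- Four patches lie around the square of `d`, four around the antipodal one, and changing one bit
crosses one side. Bits 0 and 1 exchange roles at the antipodal square because `acrossDart` inverts
`φ`; the reflection of odd patches is absorbed by `patchSwap`. -/
theorem cornerDart_update {d : G.Dart} (hd : IsSide R.facePerm (dartFlip G) (k + 1) d)
    (ε : Fin 3 → Bool) (r : Fin 3) :
    cornerDart R k d (update ε r (!ε r)) =
      outerDart R k (cornerDart R k d ε) (patchSwap ε r) := by
  have key : ∀ x, IsSide R.facePerm (dartFlip G) (k + 1) x →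
      R.facePerm.symm (R.facePerm.symm x) = R.facePerm (R.facePerm x) ∧
      R.facePerm (R.facePerm (R.facePerm x)) = R.facePerm.symm x := fun x hx =>
    ⟨symm_symm_eq hx.start, by rw [Equiv.eq_symm_apply, four_of_period hx.start]⟩
  have a1 := acrossDart_acrossDart h hd
  have a2 := acrossDart_facePerm h hd
  have a3 := acrossDart_symm h hd
  have a4 := acrossDart_facePerm h (h.isSide_turn hd)
  have hd' := isSide_acrossDart h hd
  have b2 := acrossDart_facePerm h hd'
  have b3 := acrossDart_symm h hd'
  have b4 := acrossDart_facePerm h (h.isSide_turn hd')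
  obtain ⟨k1, k2⟩ := key d hd
  obtain ⟨k1', k2'⟩ := key _ hd'
  rw [a2, k1'] at a4
  rw [b2, a1, k1] at b4
  obtain ⟨a, b, c, rfl⟩ : ∃ a b c, ε = ![a, b, c] := ⟨ε 0, ε 1, ε 2, by
    funext j; fin_cases j <;> rfl⟩
  have s2 : (swap 0 1 : Perm (Fin 3)) 2 = 2 := by decide
  fin_cases r <;> cases a <;> cases b <;> cases c <;>
    simp [cornerDart, patchSwap, outerDart, turnBits, s2, k1, k2, k1', k2', a1, a2, a3, a4, b2,
      b3, b4]

omit h [Finite V] in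
theorem patchSwap_update (ε : Fin 3 → Bool) (r : Fin 3) :
    patchSwap (update ε r (!ε r)) = patchSwap ε * swap 0 1 := by
  obtain ⟨a, b, c, rfl⟩ : ∃ a b c, ε = ![a, b, c] := ⟨ε 0, ε 1, ε 2, by
    funext j; fin_cases j <;> rfl⟩
  revert r a b c
  decide

omit h [Finite V] in
theorem patchSwap_patchSwap (ε : Fin 3 → Bool) (r : Fin 3) :
    patchSwap ε (patchSwap ε r) = r := by
  unfold patchSwap
  split_ifs <;> simp

omit h [Finite V] in
theorem add_single_comp_patchSwap (ε : Fin 3 → Bool) (t : Fin 3 → ℕ) (r : Fin 3) (n : ℕ) :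
    (t + Pi.single r n) ∘ patchSwap ε = t ∘ patchSwap ε + Pi.single (patchSwap ε r) n := by
  funext j
  simp only [comp_apply, Pi.add_apply, Pi.single_apply]
  congr 2
  refine propext ⟨fun hj => ?_, fun hj => ?_⟩
  · rw [← hj, patchSwap_patchSwap]
  · rw [hj, patchSwap_patchSwap]

omit h [Finite V] in
theorem sum_comp_patchSwap (ε : Fin 3 → Bool) (t : Fin 3 → ℕ) :
    (t ∘ patchSwap ε) 0 + (t ∘ patchSwap ε) 1 + (t ∘ patchSwap ε) 2 = t 0 + t 1 + t 2 := by
  have s2 : (swap 0 1 : Perm (Fin 3)) 2 = 2 := by decide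
  unfold patchSwap
  split_ifs <;> simp [s2]
  omega

/-- The covering of a map with a line system by a Goodey graph. -/
def goodeyCover (hG : IsCubic G) {d : G.Dart}
    (hd : IsSide R.facePerm (dartFlip G) (k + 1) d) : GoodeyCover R k where
  toFun x := patchVertex R k (cornerDart R k d x.1) (x.2.1 ∘ patchSwap x.1)
  dart x r := patchDart R k (cornerDart R k d x.1) (x.2.1 ∘ patchSwap x.1) (patchSwap x.1 r)
  -- The corner of `patchDart_period` is in the coordinates of the patch itself, so the direction is
  -- translated there and the answer back.
  turn ε r := patchSwap ε (patchSwap ε r + 2)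
  dart_fst x r := patchDart_fst _ _ _
  dart_inj x := (patchDart_injective hG _ _).comp (patchSwap x.1).injective
  dart_snd r x y hxy := by
    obtain ⟨ε, t, ht⟩ := x
    obtain ⟨ε', t', ht'⟩ := y
    have hs := sum_comp_patchSwap ε t
    have hs' := sum_comp_patchSwap ε' t'
    have e1 := sum_add_single t r
    have e2 := sum_add_single t' r
    have hc := isSide_cornerDart h hd
    rcases hxy with ⟨h1, h2 | h2⟩ | ⟨h1, h2, h3, h4⟩
    · simp only at h1 h2 ⊢
      subst h1 h2
      rw [add_single_comp_patchSwap]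
      exact (patchDart_inner h (hc ε) _ (by omega) _).1
    · simp only at h1 h2 ⊢
      subst h1 h2
      rw [add_single_comp_patchSwap]
      exact (patchDart_inner h (hc ε) _ (by omega) _).2
    · simp only [Subtype.mk.injEq] at h1 h2 h3 h4 ⊢
      subst h1 h4
      rw [patchDart_outer h (hc ε) _ (by omega) _ (by rw [comp_apply, patchSwap_patchSwap, h3]),
        cornerDart_update h hd, patchSwap_update]
      rfl
  period x r := by
    have hs := sum_comp_patchSwap x.1 x.2.1
    exact ((patchDart_period h (isSide_cornerDart h hd x.1) _ (by rw [hs]; exact x.2.2) _).imp_right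
      And.left).symm
  corner x r hr := by
    have hs := sum_comp_patchSwap x.1 x.2.1
    have e := ((patchDart_period h (isSide_cornerDart h hd x.1) _ (by rw [hs]; exact x.2.2)
      _).resolve_left (by rw [hr]; norm_num)).2
    have e2 := add_single_comp_patchSwap x.1 0 (patchSwap x.1 (patchSwap x.1 r + 2)) k
    rw [zero_add, patchSwap_patchSwap, Pi.zero_comp, zero_add, ← e] at e2
    funext j
    have := congrFun e2 (patchSwap x.1 j)
    simp only [comp_apply, patchSwap_patchSwap] at this
    exact this.symm

omit h in
/-- A plane cubic graph with a line system and a face of size four is a Goodey graph. -/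
theorem exists_iso_goodeyGraph (hG : IsCubic G) (hR : R.IsPlane)
    (hB : LineSystem R.facePerm (dartFlip G) B) {d : G.Dart}
    (hd : minimalPeriod R.facePerm d = 4) : ∃ k, Nonempty (G ≃g goodeyGraph k) := by
  obtain ⟨ℓ, e, hℓ, he⟩ := exists_minimalLine (isCubicMap hG) hB hd
  obtain ⟨k, rfl⟩ : ∃ k, ℓ = k + 1 := ⟨ℓ - 1, by have := hℓ.pos; omega⟩
  exact ⟨k, (goodeyCover hℓ hG he).nonempty_iso hG hR⟩

end Glue

/-- The structure theorem: the first half of the main theorem. -/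
theorem distanceTwoColorable_iff {V : Type u} [Finite V] {G : SimpleGraph V}
    {R : RotationSystem G} (hR : R.IsTypeTwoBarnette) :
    DistanceTwoColorable G 4 ↔ (∃ k : ℕ, Nonempty (G ≃g goodeyGraph k)) ∨
      ∀ f : R.Face, R.faceSize f = 3 ∨ R.faceSize f = 6 := by
  obtain ⟨hplane, hG, hsize⟩ := hR
  constructor
  · rintro ⟨c, hc⟩
    have hB := lineSystem_of_coloring hG hc hsize
    by_cases h4 : ∃ d, minimalPeriod R.facePerm d = 4
    · obtain ⟨d, hd⟩ := h4
      exact Or.inl (exists_iso_goodeyGraph hG hplane hB hd)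
    · right
      rintro ⟨d⟩
      change R.faceSize (R.faceOf d) = 3 ∨ R.faceSize (R.faceOf d) = 6
      rw [faceSize_faceOf]
      have h1 := hB.period d
      have h2 : minimalPeriod R.facePerm d ≠ 4 := fun h => h4 ⟨d, h⟩
      tauto
  · rintro (⟨k, ⟨e⟩⟩ | h)
    · exact (goodeyGraph_distanceTwoColorable k).of_iso e
    · refine distanceTwoColorable_of_lineSystem hG hplane (B := ∅) ?_
      have h' : ∀ d, minimalPeriod R.facePerm d = 3 ∨ minimalPeriod R.facePerm d = 6 := fun d => by
        rw [← faceSize_faceOf]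
        exact h _
      refine ⟨fun d hd => hd, fun d => by have := h' d; tauto, fun d _ hd => hd,
        fun d hd => ?_, fun d _ hd => hd, fun d _ hd => hd.elim⟩
      have := h' d
      omega


open Function Equiv RotationSystem

/-! ### Deciding the existence of a line system -/

section Criterion

variable {D : Type*} [Finite D] {φ α : Perm D} {B : Set D}

/-- Follow a line, turning back at faces whose size is not six. -/
noncomputable def followLine (φ α : Perm D) (d : D) : D :=
  if minimalPeriod φ (α d) = 6 then φ (φ (φ (α d))) else α d

/-- Follow a line until it meets a face of size four. -/
noncomputable def seekSquare (φ α : Perm D) (d : D) : D :=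
  if minimalPeriod φ d = 4 then d else followLine φ α d

theorem minimalPeriod_followLine (d : D) :
    minimalPeriod φ (followLine φ α d) = minimalPeriod φ (α d) := by
  unfold followLine
  split_ifs <;> simp [minimalPeriod_perm_apply]

/-- The image lies on the face of `α d`, so its face size reveals which branch was taken. -/
theorem followLine_injective : Injective (followLine φ α) := by
  intro x y hxy
  have h := congrArg (minimalPeriod φ) hxy
  rw [minimalPeriod_followLine, minimalPeriod_followLine] at h
  unfold followLine at hxy
  rw [h] at hxy
  split_ifs at hxy
  · exact α.injective (φ.injective (φ.injective (φ.injective hxy)))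
  · exact α.injective hxy

/-- The line through `d` meets a face of size four. -/
def MeetsSquare (φ α : Perm D) (d : D) : Prop :=
  ∃ i, minimalPeriod φ ((followLine φ α)^[i] d) = 4

/-- Orbits are cycles: a square at `d` itself is met again when the orbit closes. -/
theorem meetsSquare_followLine_iff (d : D) :
    MeetsSquare φ α (followLine φ α d) ↔ MeetsSquare φ α d := by
  constructor
  · rintro ⟨i, hi⟩
    exact ⟨i + 1, hi⟩
  · rintro ⟨_ | i, hi⟩
    · have hp := iterate_minimalPeriod (f := followLine φ α) (x := d)
      obtain ⟨p, h⟩ : ∃ p, minimalPeriod (followLine φ α) d = p + 1 :=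
        Nat.exists_eq_add_one.2 (minimalPeriod_pos_of_mem_periodicPts
          (followLine_injective.mem_periodicPts d))
      rw [h] at hp
      refine ⟨p, ?_⟩
      rw [← iterate_succ_apply, hp]
      exact hi
    · exact ⟨i, hi⟩

/-- Reversing darts conjugates `followLine` into its inverse, so the reversed line meets the same
faces. -/
theorem MeetsSquare.flip (hα : ∀ d, α (α d) = d) {d : D} (h : MeetsSquare φ α d) :
    MeetsSquare φ α (α d) := by
  obtain ⟨i, hi⟩ := h
  induction i generalizing d with
  | zero =>
    refine ⟨1, ?_⟩
    rw [iterate_one, minimalPeriod_followLine, hα]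
    exact hi
  | succ i ih =>
    have h1 := (meetsSquare_followLine_iff _).2 (ih hi)
    have h2 : followLine φ α (α (followLine φ α d)) = α d := by
      rw [followLine, hα, minimalPeriod_followLine]
      split_ifs with h6
      · rw [followLine, if_pos h6, six_of_period h6]
      · rw [followLine, if_neg h6]
    rwa [h2] at h1

/-- An orbit has at most `Nat.card D` darts, so a square is reached within `N` steps or never, and
`seekSquare` stays there. -/
theorem meetsSquare_iff {N : ℕ} (hN : Nat.card D ≤ N) (d : D) :
    MeetsSquare φ α d ↔ minimalPeriod φ ((seekSquare φ α)^[N] d) = 4 := by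
  classical
  constructor
  · intro h
    have hspec := Nat.find_spec h
    set i := Nat.find h with hi
    have hlt : i < minimalPeriod (followLine φ α) d := by
      by_contra hge
      have hpos := minimalPeriod_pos_of_mem_periodicPts
        (followLine_injective (φ := φ) (α := α).mem_periodicPts d)
      rw [← iterate_mod_minimalPeriod_eq] at hspec
      exact Nat.find_min h ((Nat.mod_lt i hpos).trans_le (not_lt.1 hge)) hspec
    have hiN : i ≤ N := by
      have := Fintype.ofFinite D
      rw [Nat.card_eq_fintype_card] at hN
      exact (hlt.le.trans minimalPeriod_le_card).trans hN
    have h1 : ∀ m, m ≤ i → (seekSquare φ α)^[m] d = (followLine φ α)^[m] d := by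
      intro m
      induction m with
      | zero => exact fun _ => rfl
      | succ m ih =>
        intro hm
        rw [iterate_succ_apply', ih (by omega), iterate_succ_apply', seekSquare,
          if_neg (Nat.find_min h (by omega))]
    have h2 : seekSquare φ α ((followLine φ α)^[i] d) = (followLine φ α)^[i] d := if_pos hspec
    obtain ⟨m, rfl⟩ := Nat.exists_eq_add_of_le hiN
    rw [Nat.add_comm, iterate_add_apply, h1 i le_rfl, iterate_fixed h2]
    exact hspec
  · intro h
    have key : ∀ m d, MeetsSquare φ α ((seekSquare φ α)^[m] d) → MeetsSquare φ α d := by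
      intro m
      induction m with
      | zero => exact fun d h => h
      | succ m ih =>
        intro d h
        have := ih _ h
        unfold seekSquare at this
        split_ifs at this
        · exact this
        · exact (meetsSquare_followLine_iff d).1 this
    exact key N d ⟨0, h⟩

/-- A cubic map with small faces has a line system if and only if the lines through the faces of
size four form one. -/
theorem exists_lineSystem_iff (hα : ∀ d, α (α d) = d)
    (hper : ∀ d, minimalPeriod φ d = 3 ∨ minimalPeriod φ d = 4 ∨ minimalPeriod φ d = 5 ∨
      minimalPeriod φ d = 6) :
    (∃ B, LineSystem φ α B) ↔ ∀ d, minimalPeriod φ d ≠ 5 ∧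
      (minimalPeriod φ d = 3 → ¬ MeetsSquare φ α d) ∧
      (minimalPeriod φ d = 6 → ¬ (MeetsSquare φ α d ∧ MeetsSquare φ α (φ d))) := by
  constructor
  · rintro ⟨B, hB⟩
    -- Membership propagates backwards along lines, so every dart whose line meets a square is
    -- forced into `B`.
    have key : ∀ d, followLine φ α d ∈ B → d ∈ B := by
      intro d hd
      rw [← hB.flip_mem_iff hα]
      unfold followLine at hd
      split_ifs at hd with h6
      · have := hB.opp _ (by simpa [minimalPeriod_perm_apply] using h6) hd
        rwa [six_of_period h6] at this
      · exact hd
    have hmem : ∀ d, MeetsSquare φ α d → d ∈ B := by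
      rintro d ⟨i, hi⟩
      have h1 := hB.sq _ hi
      clear hi
      induction i generalizing d with
      | zero => exact h1
      | succ i ih => exact key d (ih _ h1)
    refine fun d => ⟨fun h5 => ?_, fun h3 hd => hB.tri d h3 (hmem d hd),
      fun h6 hd => hB.adj d h6 (hmem _ hd.1) (hmem _ hd.2)⟩
    have := hB.period d
    omega
  · intro h
    refine ⟨{d | MeetsSquare φ α d}, fun d hd => MeetsSquare.flip hα hd, fun d => ?_,
      fun d => (h d).2.1, fun d hd => ⟨0, hd⟩, fun d h6 hd => ?_,
      fun d h6 hd hd' => (h d).2.2 h6 ⟨hd, hd'⟩⟩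
    · have h1 := hper d
      have h2 := (h d).1
      tauto
    · have h1 := (meetsSquare_followLine_iff _).2 (MeetsSquare.flip hα hd)
      rwa [followLine, hα, if_pos h6] at h1

end Criterion


open Function Equiv RotationSystem

/-! ### Programs for the random access machine -/

section Programs

namespace BarnetteInstance

/-- The length of the input. -/
def size (I : BarnetteInstance) : ℕ := I.encode.length

/-- The memory that holds the input. -/
def memory (I : BarnetteInstance) (a : ℕ) : ℕ := I.encode.getD a 0

end BarnetteInstance

/-- The state `s'` arises from `s` within `T` steps by `c`, which writes to no memory cell and to no
register below `b`. -/
def RunsAbove (b : ℕ) (c : Cmd) (T : ℕ) (s s' : State) : Prop :=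
  (∃ t ≤ T, Runs c s s' t) ∧ s'.mem = s.mem ∧ ∀ r < b, s'.reg r = s.reg r

theorem RunsAbove.seq {b : ℕ} {c c' : Cmd} {T T' : ℕ} {s s' s'' : State}
    (h : RunsAbove b c T s s') (h' : RunsAbove b c' T' s' s'') :
    RunsAbove b (.seq c c') (T + T') s s'' := by
  obtain ⟨⟨t, ht, hr⟩, hm, hreg⟩ := h
  obtain ⟨⟨t', ht', hr'⟩, hm', hreg'⟩ := h'
  exact ⟨⟨t + t', add_le_add ht ht', .seq hr hr'⟩, hm'.trans hm,
    fun r hlt => (hreg' r hlt).trans (hreg r hlt)⟩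

theorem RunsAbove.mono {b b' : ℕ} {c : Cmd} {T T' : ℕ} {s s' : State} (h : RunsAbove b c T s s')
    (hb : b' ≤ b) (hT : T ≤ T') : RunsAbove b' c T' s s' := by
  obtain ⟨⟨t, ht, hr⟩, hm, hreg⟩ := h
  exact ⟨⟨t, ht.trans hT, hr⟩, hm, fun r hlt => hreg r (hlt.trans_le hb)⟩

theorem RunsAbove.iteTrue {b r : ℕ} {c c' : Cmd} {T : ℕ} {s s' : State} (hr : s.reg r ≠ 0)
    (h : RunsAbove b c T s s') : RunsAbove b (.ite r c c') (T + 1) s s' := by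
  obtain ⟨⟨t, ht, hr'⟩, hm, hreg⟩ := h
  exact ⟨⟨t + 1, by omega, .iteTrue hr hr'⟩, hm, hreg⟩

theorem RunsAbove.iteFalse {b r : ℕ} {c c' : Cmd} {T : ℕ} {s s' : State} (hr : s.reg r = 0)
    (h : RunsAbove b c' T s s') : RunsAbove b (.ite r c c') (T + 1) s s' := by
  obtain ⟨⟨t, ht, hr'⟩, hm, hreg⟩ := h
  exact ⟨⟨t + 1, by omega, .iteFalse hr hr'⟩, hm, hreg⟩

theorem RunsAbove.loopDone {b r : ℕ} {c : Cmd} {s : State} (hr : s.reg r = 0) :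
    RunsAbove b (.loop r c) 1 s s :=
  ⟨⟨1, le_rfl, .loopDone hr⟩, rfl, fun _ _ => rfl⟩

theorem RunsAbove.loopStep {b r : ℕ} {c : Cmd} {T T' : ℕ} {s s' s'' : State} (hr : s.reg r ≠ 0)
    (h : RunsAbove b c T s s') (h' : RunsAbove b (.loop r c) T' s' s'') :
    RunsAbove b (.loop r c) (T + T' + 1) s s'' := by
  obtain ⟨⟨t, ht, hr1⟩, hm, hreg⟩ := h
  obtain ⟨⟨t', ht', hr2⟩, hm', hreg'⟩ := h'
  exact ⟨⟨t + t' + 1, by omega, .loopStep hr hr1 hr2⟩, hm'.trans hm,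
    fun r hlt => (hreg' r hlt).trans (hreg r hlt)⟩

theorem runsAbove_setReg {b r n : ℕ} {c : Cmd} {s : State} (hr : b ≤ r)
    (h : Runs c s (s.setReg r n) 1) : RunsAbove b c 1 s (s.setReg r n) :=
  ⟨⟨1, le_rfl, h⟩, rfl, fun r' hlt => update_of_ne (by omega) _ _⟩

theorem State.setReg_reg (s : State) (r n r' : ℕ) :
    (s.setReg r n).reg r' = if r' = r then n else s.reg r' := by
  simp [State.setReg, Function.update_apply]

/-- Move the contents of register `a` to register `r`. -/
def Cmd.move (r a : ℕ) : Cmd := .seq (.const r 0) (.add r r a)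

theorem runsAbove_move {b r a : ℕ} (s : State) (hr : b ≤ r) (ha : a ≠ r) :
    ∃ s', RunsAbove b (.move r a) 2 s s' ∧ s'.reg r = s.reg a ∧
      ∀ r', r' ≠ r → s'.reg r' = s.reg r' := by
  refine ⟨_, (runsAbove_setReg hr (.const s r 0)).seq (runsAbove_setReg hr (.add _ r r a)), ?_, ?_⟩
  · simp [State.setReg_reg, ha]
  · intro r' h'
    simp [State.setReg_reg, h']

/-- A family of functions on the indices of input cells can be computed in place in any register
except `0`, in polynomial time and without changing the memory or the registers below. -/
def Computable (f : BarnetteInstance → ℕ → ℕ) : Prop :=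
  ∀ b ≥ 1, ∃ (c : Cmd) (p : Polynomial ℕ), ∀ (I : BarnetteInstance) (s : State),
    s.mem = I.memory → s.reg 0 = I.size → s.reg b < I.size →
      ∃ s', RunsAbove b c (p.eval I.size) s s' ∧ s'.reg b = f I (s.reg b)

/-- A family of functions maps indices of input cells to indices of input cells. -/
def PreservesIndices (f : BarnetteInstance → ℕ → ℕ) : Prop :=
  ∀ I x, x < I.size → f I x < I.size

namespace Computable

variable {f g p : BarnetteInstance → ℕ → ℕ}

theorem congr (hf : Computable f) (h : ∀ I x, x < I.size → f I x = g I x) : Computable g := by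
  intro b hb
  obtain ⟨c, p, hc⟩ := hf b hb
  refine ⟨c, p, fun I s hm h0 hx => ?_⟩
  obtain ⟨s', h1, h2⟩ := hc I s hm h0 hx
  exact ⟨s', h1, h2.trans (h I _ hx)⟩

theorem id : Computable fun _ x => x := fun b _ =>
  ⟨.skip, 1, fun I s _ _ _ => ⟨s, ⟨⟨1, by simp, .skip s⟩, rfl, fun _ _ => rfl⟩, rfl⟩⟩

theorem const (n : ℕ) : Computable fun _ _ => n := fun b _ =>
  ⟨.const b n, 1, fun I s _ _ _ => ⟨s.setReg b n,
    (runsAbove_setReg le_rfl (.const s b n)).mono le_rfl (by simp), by simp [State.setReg_reg]⟩⟩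

theorem size : Computable fun I _ => I.size := fun b hb =>
  ⟨.move b 0, 2, fun I s _ h0 _ => by
    obtain ⟨s', h1, h2, -⟩ := runsAbove_move (b := b) s le_rfl (show 0 ≠ b by omega)
    exact ⟨s', h1.mono le_rfl (by simp), h2.trans h0⟩⟩

/-- `Computable` promises correctness only for arguments below the input length, so the inner value
must stay in that range. -/
theorem comp (hg : Computable g) (hf : Computable f) (hp : PreservesIndices f) :
    Computable fun I x => g I (f I x) := by
  intro b hb
  obtain ⟨c, p, hc⟩ := hf b hb
  obtain ⟨c', p', hc'⟩ := hg b hb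
  refine ⟨.seq c c', p + p', fun I s hm h0 hx => ?_⟩
  obtain ⟨s', h1, h2⟩ := hc I s hm h0 hx
  obtain ⟨s'', h3, h4⟩ := hc' I s' (h1.2.1.trans hm) ((h1.2.2 0 (by omega)).trans h0)
    (by rw [h2]; exact hp I _ hx)
  exact ⟨s'', by simpa using h1.seq h3, by rw [h4, h2]⟩

theorem branch (hp : Computable p) (hf : Computable f) (hg : Computable g) :
    Computable fun I x => if p I x ≠ 0 then f I x else g I x := by
  intro b hb
  obtain ⟨c, P, hc⟩ := hp (b + 1) (by omega)
  obtain ⟨c₁, P₁, hc₁⟩ := hf b hb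
  obtain ⟨c₂, P₂, hc₂⟩ := hg b hb
  refine ⟨.seq (.move (b + 1) b) (.seq c (.ite (b + 1) c₁ c₂)), 2 + (P + (P₁ + P₂ + 1)),
    fun I s hm h0 hx => ?_⟩
  obtain ⟨s₁, a1, a2, a3⟩ := runsAbove_move (b := b + 1) (r := b + 1) (a := b) s le_rfl (by omega)
  have a4 := a3 b (by omega)
  have a5 := a3 0 (by omega)
  obtain ⟨s₂, b1, b2⟩ := hc I s₁ (a1.2.1.trans hm) (a5.trans h0) (by rwa [a2])
  rw [a2] at b2
  have b3 : s₂.reg b = s.reg b := (b1.2.2 b (by omega)).trans a4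
  have b4 : s₂.reg 0 = I.size := (b1.2.2 0 (by omega)).trans (a5.trans h0)
  have b5 : s₂.mem = I.memory := b1.2.1.trans (a1.2.1.trans hm)
  have key : ∀ s₃, RunsAbove b (.ite (b + 1) c₁ c₂) (P₁.eval I.size + P₂.eval I.size + 1) s₂ s₃ →
      RunsAbove b (.seq (.move (b + 1) b) (.seq c (.ite (b + 1) c₁ c₂)))
        ((2 + (P + (P₁ + P₂ + 1)) : Polynomial ℕ).eval I.size) s s₃ := fun s₃ h3 => by
    have := (a1.mono (show b ≤ b + 1 by omega) le_rfl).seq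
      ((b1.mono (show b ≤ b + 1 by omega) le_rfl).seq h3)
    simpa using this
  by_cases h : p I (s.reg b) = 0
  · obtain ⟨s₃, d1, d2⟩ := hc₂ I s₂ b5 b4 (by rwa [b3])
    refine ⟨s₃, key s₃ (.iteFalse (by rw [b2, h]) (d1.mono le_rfl (by omega))), ?_⟩
    rw [d2, b3]
    simp [h]
  · obtain ⟨s₃, d1, d2⟩ := hc₁ I s₂ b5 b4 (by rwa [b3])
    refine ⟨s₃, key s₃ (.iteTrue (by rwa [b2]) (d1.mono le_rfl (by omega))), ?_⟩
    rw [d2, b3]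
    simp [h]

/-- Evaluate two functions into the registers `b + 1` and `b + 2`. -/
theorem pair (hf : Computable f) (hg : Computable g) (b : ℕ) (hb : 1 ≤ b) :
    ∃ (c : Cmd) (p : Polynomial ℕ), ∀ (I : BarnetteInstance) (s : State),
      s.mem = I.memory → s.reg 0 = I.size → s.reg b < I.size →
        ∃ s', RunsAbove (b + 1) c (p.eval I.size) s s' ∧ s'.reg (b + 1) = f I (s.reg b) ∧
          s'.reg (b + 2) = g I (s.reg b) := by
  obtain ⟨c₁, P₁, hc₁⟩ := hf (b + 1) (by omega)
  obtain ⟨c₂, P₂, hc₂⟩ := hg (b + 2) (by omega)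
  refine ⟨.seq (.seq (.move (b + 1) b) c₁) (.seq (.move (b + 2) b) c₂), (2 + P₁) + (2 + P₂),
    fun I s hm h0 hx => ?_⟩
  obtain ⟨s₁, a1, a2, a3⟩ := runsAbove_move (b := b + 1) (r := b + 1) (a := b) s le_rfl (by omega)
  obtain ⟨s₂, b1, b2⟩ := hc₁ I s₁ (a1.2.1.trans hm) ((a3 0 (by omega)).trans h0) (by rwa [a2])
  have e1 := a1.seq b1
  have x2 : s₂.reg b = s.reg b := e1.2.2 b (by omega)
  obtain ⟨s₃, d1, d2, d3⟩ := runsAbove_move (b := b + 2) (r := b + 2) (a := b) s₂ le_rfl (by omega)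
  obtain ⟨s₄, f1, f2⟩ := hc₂ I s₃ (d1.2.1.trans (e1.2.1.trans hm))
    ((d3 0 (by omega)).trans ((e1.2.2 0 (by omega)).trans h0)) (by rwa [d2, x2])
  have e2 := d1.seq f1
  refine ⟨s₄, by simpa using e1.seq (e2.mono (by omega) le_rfl), ?_, ?_⟩
  · rw [e2.2.2 (b + 1) (by omega), b2, a2]
  · rw [f2, d2, x2]

theorem add (hf : Computable f) (hg : Computable g) : Computable fun I x => f I x + g I x := by
  intro b hb
  obtain ⟨c, P, hc⟩ := pair hf hg b hb
  refine ⟨.seq c (.add b (b + 1) (b + 2)), P + 1, fun I s hm h0 hx => ?_⟩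
  obtain ⟨s₁, a1, a2, a3⟩ := hc I s hm h0 hx
  have a4 := (a1.mono (show b ≤ b + 1 by omega) le_rfl).seq
    (runsAbove_setReg le_rfl (.add s₁ b (b + 1) (b + 2)))
  refine ⟨_, by simpa using a4, ?_⟩
  simp [State.setReg_reg, a2, a3]

theorem sub (hf : Computable f) (hg : Computable g) : Computable fun I x => f I x - g I x := by
  intro b hb
  obtain ⟨c, P, hc⟩ := pair hf hg b hb
  refine ⟨.seq c (.sub b (b + 1) (b + 2)), P + 1, fun I s hm h0 hx => ?_⟩
  obtain ⟨s₁, a1, a2, a3⟩ := hc I s hm h0 hx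
  have a4 := (a1.mono (show b ≤ b + 1 by omega) le_rfl).seq
    (runsAbove_setReg le_rfl (.sub s₁ b (b + 1) (b + 2)))
  refine ⟨_, by simpa using a4, ?_⟩
  simp [State.setReg_reg, a2, a3]

/-- Two numbers are equal when both truncated differences vanish. -/
theorem eqTest (hf : Computable f) (hg : Computable g) :
    Computable fun I x => if f I x = g I x then 1 else 0 :=
  (branch ((sub hf hg).add (sub hg hf)) (const 0) (const 1)).congr fun I x _ => by
    by_cases h : f I x = g I x
    · simp [h]
    · rw [if_neg h, if_pos (by omega)]

theorem load (hf : Computable f) : Computable fun I x => I.memory (f I x) := by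
  intro b hb
  obtain ⟨c, P, hc⟩ := hf b hb
  refine ⟨.seq c (.load b b), P + 1, fun I s hm h0 hx => ?_⟩
  obtain ⟨s₁, a1, a2⟩ := hc I s hm h0 hx
  refine ⟨_, by simpa using a1.seq (runsAbove_setReg le_rfl (.load s₁ b b)), ?_⟩
  simp [State.setReg_reg, a2, a1.2.1, hm]

theorem iterate (hf : Computable f) (hp : PreservesIndices f) :
    Computable fun I x => (f I)^[I.size] x := by
  intro b hb
  obtain ⟨c, P, hc⟩ := hf (b + 2) (by omega)
  -- Register `b` counts down, `b + 1` holds the constant 1, and `b + 2` holds the current value.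
  have hloop : ∀ (I : BarnetteInstance) (n : ℕ) (s : State), s.mem = I.memory →
      s.reg 0 = I.size → s.reg (b + 2) < I.size → s.reg b = n → s.reg (b + 1) = 1 →
      ∃ s', RunsAbove b (.loop b (.seq c (.sub b b (b + 1)))) (n * (P.eval I.size + 2) + 1) s s' ∧
        s'.reg (b + 2) = (f I)^[n] (s.reg (b + 2)) := by
    intro I n
    induction n with
    | zero =>
      intro s _ _ _ hn _
      exact ⟨s, (RunsAbove.loopDone hn).mono le_rfl (by omega), rfl⟩
    | succ n ih =>
      intro s hm h0 hx hn h1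
      obtain ⟨s₁, a1, a2⟩ := hc I s hm h0 hx
      have a3 := a1.2.2 b (by omega)
      have a4 := a1.2.2 (b + 1) (by omega)
      have a5 := a1.2.2 0 (by omega)
      have b1 := (a1.mono (show b ≤ b + 2 by omega) le_rfl).seq
        (runsAbove_setReg (b := b) le_rfl (.sub s₁ b b (b + 1)))
      obtain ⟨s₂, d1, d2⟩ := ih (s₁.setReg b (s₁.reg b - s₁.reg (b + 1)))
        (a1.2.1.trans hm) (by rw [State.setReg_reg, if_neg (by omega), a5, h0])
        (by rw [State.setReg_reg, if_neg (by omega), a2]; exact hp I _ hx)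
        (by rw [State.setReg_reg, if_pos rfl, a3, a4, hn, h1]; rfl)
        (by rw [State.setReg_reg, if_neg (by omega), a4, h1])
      refine ⟨s₂, (RunsAbove.loopStep (by omega) b1 d1).mono le_rfl (by ring_nf; omega), ?_⟩
      rw [d2, State.setReg_reg, if_neg (by omega), a2, ← iterate_succ_apply]
  refine ⟨.seq (.move (b + 2) b) (.seq (.move b 0) (.seq (.const (b + 1) 1)
    (.seq (.loop b (.seq c (.sub b b (b + 1)))) (.move b (b + 2))))),
    2 + (2 + (1 + ((.X * (P + 2) + 1) + 2))), fun I s hm h0 hx => ?_⟩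
  obtain ⟨s₁, a1, a2, a3⟩ := runsAbove_move (b := b) (r := b + 2) (a := b) s (by omega) (by omega)
  obtain ⟨s₂, b1, b2, b3⟩ := runsAbove_move (b := b) (r := b) (a := 0) s₁ le_rfl (by omega)
  have d1 := runsAbove_setReg (b := b) (show b ≤ b + 1 by omega) (.const s₂ (b + 1) 1)
  obtain ⟨s₃, e1, e2⟩ := hloop I I.size (s₂.setReg (b + 1) 1) (b1.2.1.trans (a1.2.1.trans hm))
    (by rw [State.setReg_reg, if_neg (by omega), b3 0 (by omega), a3 0 (by omega), h0])
    (by rwa [State.setReg_reg, if_neg (by omega), b3 _ (by omega), a2])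
    (by rw [State.setReg_reg, if_neg (by omega), b2, a3 0 (by omega), h0])
    (by rw [State.setReg_reg, if_pos rfl])
  obtain ⟨s₄, f1, f2, -⟩ := runsAbove_move (b := b) (r := b) (a := b + 2) s₃ le_rfl (by omega)
  refine ⟨s₄, by simpa using a1.seq (b1.seq (d1.seq (e1.seq f1))), ?_⟩
  rw [f2, e2, State.setReg_reg, if_neg (by omega), b3 _ (by omega), a2]

theorem divThree : Computable fun _ x => x / 3 := by
  intro b hb
  -- Repeated subtraction of 3, with the quotient in `b + 1`. Register `b + 4` holds the truncated
  -- `x - 2`, which is nonzero exactly when `x ≥ 3`.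
  have hloop : ∀ (x q : ℕ) (s : State), s.reg b = x → s.reg (b + 1) = q → s.reg (b + 2) = 2 →
      s.reg (b + 3) = 3 → s.reg (b + 4) = x - 2 → s.reg (b + 5) = 1 →
      ∃ s', RunsAbove b (.loop (b + 4) (.seq (.sub b b (b + 3)) (.seq (.add (b + 1) (b + 1) (b + 5))
        (.sub (b + 4) b (b + 2))))) (x * 4 + 1) s s' ∧ s'.reg (b + 1) = q + x / 3 := by
    intro x
    induction x using Nat.strong_induction_on with
    | _ x ih =>
      intro q s h0 h1 h2 h3 h4 h5
      by_cases hx : x - 2 = 0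
      · refine ⟨s, (RunsAbove.loopDone (by rw [h4, hx])).mono le_rfl (by omega), ?_⟩
        rw [h1, Nat.div_eq_of_lt (by omega), add_zero]
      · have a1 := runsAbove_setReg (b := b) le_rfl (.sub s b b (b + 3))
        set s₁ := s.setReg b (s.reg b - s.reg (b + 3)) with hs₁
        have a2 := runsAbove_setReg (b := b) (by omega) (.add s₁ (b + 1) (b + 1) (b + 5))
        set s₂ := s₁.setReg (b + 1) (s₁.reg (b + 1) + s₁.reg (b + 5)) with hs₂
        have a3 := runsAbove_setReg (b := b) (by omega) (.sub s₂ (b + 4) b (b + 2))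
        obtain ⟨s', b1, b2⟩ := ih (x - 3) (by omega) (q + 1)
          (s₂.setReg (b + 4) (s₂.reg b - s₂.reg (b + 2)))
          (by simp [hs₁, hs₂, State.setReg_reg, h0, h3])
          (by simp [hs₁, hs₂, State.setReg_reg, h1, h5])
          (by simp [hs₁, hs₂, State.setReg_reg, h2])
          (by simp [hs₁, hs₂, State.setReg_reg, h3])
          (by simp [hs₁, hs₂, State.setReg_reg, h0, h2, h3])
          (by simp [hs₁, hs₂, State.setReg_reg, h5])
        refine ⟨s', (RunsAbove.loopStep (by omega) (a1.seq (a2.seq a3)) b1).mono le_rfl (by omega),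
          ?_⟩
        rw [b2]
        omega
  refine ⟨.seq (.const (b + 1) 0) (.seq (.const (b + 2) 2) (.seq (.const (b + 3) 3)
    (.seq (.const (b + 5) 1) (.seq (.sub (b + 4) b (b + 2)) (.seq
      (.loop (b + 4) (.seq (.sub b b (b + 3)) (.seq (.add (b + 1) (b + 1) (b + 5))
        (.sub (b + 4) b (b + 2))))) (.move b (b + 1))))))),
    1 + (1 + (1 + (1 + (1 + ((.X * 4 + 1) + 2))))), fun I s _ _ hx => ?_⟩
  have a1 := runsAbove_setReg (b := b) (by omega) (.const s (b + 1) 0)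
  set s₁ := s.setReg (b + 1) 0 with hs₁
  have a2 := runsAbove_setReg (b := b) (by omega) (.const s₁ (b + 2) 2)
  set s₂ := s₁.setReg (b + 2) 2 with hs₂
  have a3 := runsAbove_setReg (b := b) (by omega) (.const s₂ (b + 3) 3)
  set s₃ := s₂.setReg (b + 3) 3 with hs₃
  have a4 := runsAbove_setReg (b := b) (by omega) (.const s₃ (b + 5) 1)
  set s₄ := s₃.setReg (b + 5) 1 with hs₄
  have a5 := runsAbove_setReg (b := b) (by omega) (.sub s₄ (b + 4) b (b + 2))
  set s₅ := s₄.setReg (b + 4) (s₄.reg b - s₄.reg (b + 2)) with hs₅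
  obtain ⟨s₆, b1, b2⟩ := hloop (s.reg b) 0 s₅
    (by simp [hs₁, hs₂, hs₃, hs₄, hs₅, State.setReg_reg])
    (by simp [hs₁, hs₂, hs₃, hs₄, hs₅, State.setReg_reg])
    (by simp [hs₁, hs₂, hs₃, hs₄, hs₅, State.setReg_reg])
    (by simp [hs₁, hs₂, hs₃, hs₄, hs₅, State.setReg_reg])
    (by simp [hs₁, hs₂, hs₃, hs₄, hs₅, State.setReg_reg])
    (by simp [hs₁, hs₂, hs₃, hs₄, hs₅, State.setReg_reg])
  obtain ⟨s₇, c1, c2, -⟩ := runsAbove_move (b := b) (r := b) (a := b + 1) s₆ le_rfl (by omega)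
  refine ⟨s₇, (a1.seq (a2.seq (a3.seq (a4.seq (a5.seq (b1.seq c1)))))).mono le_rfl ?_, ?_⟩
  · simp
    omega
  · rw [c2, b2, zero_add]

end Computable

/-- A question that is decided by a computable function on the index `0` is solvable in polynomial
time. -/
theorem solvable_of_computable {f : BarnetteInstance → ℕ → ℕ} (hf : Computable f)
    {Q : BarnetteInstance → Prop} (hpos : ∀ I : BarnetteInstance, 0 < I.size)
    (h1 : ∀ I, Q I → f I 0 = 1) (h0 : ∀ I, ¬ Q I → f I 0 = 0) :
    SolvableInPolynomialTime BarnetteInstance.encode Q := by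
  obtain ⟨c, P, hc⟩ := hf 1 le_rfl
  refine ⟨.seq c (.move 0 1), P + 2, fun I => ?_⟩
  -- Register 1 is initially 0, which is the index at which `f` is evaluated.
  obtain ⟨s₁, a1, a2⟩ := hc I (State.init I.encode) rfl rfl (hpos I)
  obtain ⟨s₂, b1, b2, -⟩ := runsAbove_move (b := 0) (r := 0) (a := 1) s₁ le_rfl (by omega)
  obtain ⟨⟨t, ht, hr⟩, -⟩ := (a1.mono (Nat.zero_le 1) le_rfl).seq b1
  rw [a2] at b2
  exact ⟨s₂, t, hr, by simpa [BarnetteInstance.size] using ht, fun h => b2.trans (h1 I h), fun h => b2.trans (h0 I h)⟩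

end Programs


open Function Equiv RotationSystem

/-! ### The decision procedure -/

namespace BarnetteInstance

variable (I : BarnetteInstance)

theorem isCubic : IsCubic I.G := I.isTypeTwoBarnette.2.1

theorem size_eq : I.size = I.n * 3 := List.length_ofFn

/-- The `i`-th dart leaving `v`. -/
def dartAt (v : Fin I.n) (i : Fin 3) : I.G.Dart := ⟨(v, I.nbr v i), (I.nbr_spec v i).choose⟩

theorem rot_dartAt (v : Fin I.n) (i : Fin 3) : I.R.rot (I.dartAt v i) = I.dartAt v (i + 1) :=
  SimpleGraph.Dart.ext _ _ (Prod.ext (I.R.rot_fst _) (I.nbr_spec v i).choose_spec)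

theorem dartAt_injective (v : Fin I.n) : Injective (I.dartAt v) := by
  intro i j hij
  by_contra hne
  have h1 := rot_ne (R := I.R) I.isCubic (I.dartAt v i)
  have h2 := rot_rot_ne (R := I.R) I.isCubic (I.dartAt v i)
  rw [rot_dartAt] at h1
  rw [rot_dartAt, rot_dartAt] at h2
  have key : ∀ i j : Fin 3, i ≠ j → j = i + 1 ∨ j = i + 1 + 1 := by decide
  rcases key i j hne with rfl | rfl
  · exact h1 hij.symm
  · exact h2 hij.symm

theorem exists_dartAt (d : I.G.Dart) : ∃ i, I.dartAt d.fst i = d := by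
  rcases eq_of_fst_eq (R := I.R) I.isCubic (d := I.dartAt d.fst 0) (e := d) rfl with h | h | h
  · exact ⟨0, h.symm⟩
  · rw [rot_dartAt] at h
    exact ⟨_, h.symm⟩
  · rw [rot_dartAt, rot_dartAt] at h
    exact ⟨_, h.symm⟩

/-- The input cell that describes a dart. -/
noncomputable def code (d : I.G.Dart) : ℕ := 3 * d.fst + (I.exists_dartAt d).choose

theorem code_dartAt (v : Fin I.n) (i : Fin 3) : I.code (I.dartAt v i) = 3 * v + i := by
  have h := I.dartAt_injective v (I.exists_dartAt (I.dartAt v i)).choose_spec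
  unfold code
  rw [h]
  rfl

theorem code_injective : Injective I.code := by
  intro d e h
  obtain ⟨i, hi⟩ := I.exists_dartAt d
  obtain ⟨j, hj⟩ := I.exists_dartAt e
  rw [← hi, ← hj, code_dartAt, code_dartAt] at h
  have h1 : d.fst = e.fst := Fin.ext (by omega)
  have h2 : i = j := Fin.ext (by omega)
  rw [← hi, ← hj, h1, h2]

theorem code_lt (d : I.G.Dart) : I.code d < I.size := by
  obtain ⟨i, hi⟩ := I.exists_dartAt d
  rw [← hi, code_dartAt, size_eq]
  omega

theorem exists_code {j : ℕ} (hj : j < I.size) : ∃ d, I.code d = j := by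
  rw [size_eq] at hj
  refine ⟨I.dartAt ⟨j / 3, by omega⟩ ⟨j % 3, by omega⟩, ?_⟩
  rw [code_dartAt]
  exact Nat.div_add_mod j 3

theorem memory_eq (v : Fin I.n) (i : Fin 3) : I.memory (3 * v + i) = I.nbr v i := by
  have hlt : 3 * (v : ℕ) + i < I.n * 3 := by omega
  unfold memory encode
  rw [List.getD_eq_getElem _ _ (by rw [List.length_ofFn]; exact hlt), List.getElem_ofFn]
  have h1 : (⟨3 * v + i, hlt⟩ : Fin (I.n * 3)).divNat = v := Fin.ext (by
    simp only [Fin.coe_divNat]; omega)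
  have h2 : (⟨3 * v + i, hlt⟩ : Fin (I.n * 3)).modNat = i := Fin.ext (by
    simp only [Fin.coe_modNat]; omega)
  rw [h1, h2]

theorem memory_code (d : I.G.Dart) : I.memory (I.code d) = d.snd := by
  obtain ⟨i, hi⟩ := I.exists_dartAt d
  rw [← hi, code_dartAt, memory_eq]
  rfl

theorem code_div (d : I.G.Dart) : I.code d / 3 = d.fst := by
  unfold code
  omega

theorem pos : 0 < I.n := (I.isTypeTwoBarnette.1.1.nonempty.some).pos

theorem card_dart : Nat.card I.G.Dart = I.size := by
  rw [card_eq_mul_card_cycles I.R.rot (minimalPeriod_rot I.isCubic), card_cycles_rot I.isCubic,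
    Nat.card_eq_fintype_card, Fintype.card_fin, size_eq, mul_comm]

theorem period (d : I.G.Dart) : minimalPeriod I.R.facePerm d = 3 ∨
    minimalPeriod I.R.facePerm d = 4 ∨ minimalPeriod I.R.facePerm d = 5 ∨
      minimalPeriod I.R.facePerm d = 6 := by
  rw [← faceSize_faceOf]
  exact I.isTypeTwoBarnette.2.2 _

end BarnetteInstance

open BarnetteInstance

/-- A map on darts that is computable on their codes. -/
def DartComputable (F : ∀ I : BarnetteInstance, I.G.Dart → I.G.Dart) : Prop :=
  ∃ f, Computable f ∧ ∀ I d, f I (I.code d) = I.code (F I d)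

/-- A property of darts that is decidable on their codes. -/
def DartDecidable (P : ∀ I : BarnetteInstance, I.G.Dart → Prop) : Prop :=
  ∃ f, Computable f ∧ ∀ I d, (P I d → f I (I.code d) = 1) ∧ (¬ P I d → f I (I.code d) = 0)

theorem preservesIndices_of_code {f : BarnetteInstance → ℕ → ℕ}
    {F : ∀ I : BarnetteInstance, I.G.Dart → I.G.Dart}
    (h : ∀ I d, f I (I.code d) = I.code (F I d)) : PreservesIndices f := by
  intro I x hx
  obtain ⟨d, rfl⟩ := I.exists_code hx
  rw [h]
  exact I.code_lt _

/-! ### Closure properties of computable maps and decidable properties of darts. -/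

section Combinators

variable {F H : ∀ I : BarnetteInstance, I.G.Dart → I.G.Dart}
  {P Q : ∀ I : BarnetteInstance, I.G.Dart → Prop}

theorem DartComputable.id : DartComputable fun _ d => d := ⟨_, Computable.id, fun _ _ => rfl⟩

theorem DartComputable.comp (hH : DartComputable H) (hF : DartComputable F) :
    DartComputable fun I d => H I (F I d) := by
  obtain ⟨g, hg, hg'⟩ := hH
  obtain ⟨f, hf, hf'⟩ := hF
  exact ⟨_, hg.comp hf (preservesIndices_of_code hf'), fun I d => by rw [hf', hg']⟩

theorem DartComputable.iterate (hF : DartComputable F) :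
    DartComputable fun I d => (F I)^[I.size] d := by
  obtain ⟨f, hf, hf'⟩ := hF
  refine ⟨_, hf.iterate (preservesIndices_of_code hf'), fun I d => ?_⟩
  change (f I)^[I.size] (I.code d) = I.code ((F I)^[I.size] d)
  generalize I.size = n
  induction n generalizing d with
  | zero => rfl
  | succ n ih => rw [iterate_succ_apply, hf', ih, iterate_succ_apply]

theorem DartComputable.ite [∀ I d, Decidable (P I d)] (hP : DartDecidable P)
    (hF : DartComputable F) (hH : DartComputable H) :
    DartComputable fun I d => if P I d then F I d else H I d := by
  obtain ⟨p, hp, hp'⟩ := hP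
  obtain ⟨f, hf, hf'⟩ := hF
  obtain ⟨g, hg, hg'⟩ := hH
  refine ⟨_, hp.branch hf hg, fun I d => ?_⟩
  by_cases h : P I d
  · simp [h, (hp' I d).1 h, hf']
  · simp [h, (hp' I d).2 h, hg']

theorem DartDecidable.comp (hP : DartDecidable P) (hF : DartComputable F) :
    DartDecidable fun I d => P I (F I d) := by
  obtain ⟨p, hp, hp'⟩ := hP
  obtain ⟨f, hf, hf'⟩ := hF
  exact ⟨_, hp.comp hf (preservesIndices_of_code hf'), fun I d => by
    simp only [hf']
    exact hp' I (F I d)⟩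

theorem DartDecidable.eq (hF : DartComputable F) (hH : DartComputable H) :
    DartDecidable fun I d => F I d = H I d := by
  obtain ⟨f, hf, hf'⟩ := hF
  obtain ⟨g, hg, hg'⟩ := hH
  refine ⟨_, hf.eqTest hg, fun I d => ⟨fun h => ?_, fun h => ?_⟩⟩
  · rw [if_pos (by rw [hf', hg', h])]
  · rw [if_neg (by rw [hf', hg']; exact fun h' => h (I.code_injective h'))]

theorem DartDecidable.imp (hP : DartDecidable P) (hQ : DartDecidable Q) :
    DartDecidable fun I d => P I d → Q I d := by
  obtain ⟨p, hp, hp'⟩ := hP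
  obtain ⟨q, hq, hq'⟩ := hQ
  refine ⟨_, hp.branch hq (.const 1), fun I d => ?_⟩
  by_cases h : P I d
  · simpa [h, (hp' I d).1 h] using hq' I d
  · simp [h, (hp' I d).2 h]

theorem DartDecidable.not (hP : DartDecidable P) : DartDecidable fun I d => ¬ P I d :=
  hP.imp ⟨_, .const 0, fun _ _ => ⟨False.elim, fun _ => rfl⟩⟩

theorem DartDecidable.and (hP : DartDecidable P) (hQ : DartDecidable Q) :
    DartDecidable fun I d => P I d ∧ Q I d := by
  obtain ⟨f, hf, hf'⟩ := (hP.imp hQ.not).not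
  refine ⟨f, hf, fun I d => ?_⟩
  have := hf' I d
  simpa using this

theorem DartDecidable.congr (hP : DartDecidable P) (h : ∀ I d, P I d ↔ Q I d) :
    DartDecidable Q := by
  obtain ⟨p, hp, hp'⟩ := hP
  exact ⟨p, hp, fun I d => by rw [← h]; exact hp' I d⟩

/-- A property of all darts is decidable by trying them one after the other. -/
theorem DartDecidable.forall (hP : DartDecidable P) :
    ∃ f, Computable f ∧ ∀ I, ((∀ d, P I d) → f I 0 = 1) ∧ (¬ (∀ d, P I d) → f I 0 = 0) := by
  obtain ⟨p, hp, hp'⟩ := hP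
  -- A pointer advances while the property holds and stays put at a failure or at the last cell.
  -- After `I.size` steps, everything holds exactly when it is at the last cell and the property
  -- holds there.
  let next : BarnetteInstance → ℕ → ℕ := fun I x =>
    if p I x ≠ 0 then (if (if x + 1 = I.size then 1 else 0) ≠ 0 then x else x + 1) else x
  let test : BarnetteInstance → ℕ → ℕ := fun I x =>
    if p I x ≠ 0 then (if x + 1 = I.size then 1 else 0) else 0
  have hlast := Computable.eqTest (Computable.id.add (.const 1)) .size
  have hnext : Computable next := hp.branch (hlast.branch .id (Computable.id.add (.const 1))) .id
  have htest : Computable test := hp.branch hlast (.const 0)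
  have hpres : PreservesIndices next := by
    intro I x hx
    simp only [next]
    split_ifs <;> omega
  have hpres' : PreservesIndices fun I x => (next I)^[I.size] x := by
    intro I x hx
    have key : ∀ m, (next I)^[m] x < I.size := by
      intro m
      induction m with
      | zero => exact hx
      | succ m ih =>
        rw [iterate_succ_apply']
        exact hpres I _ ih
    exact key I.size
  refine ⟨_, htest.comp (hnext.iterate hpres) hpres', fun I => ⟨fun h => ?_, fun h => ?_⟩⟩
  · have hall : ∀ x < I.size, p I x = 1 := fun x hx => by
      obtain ⟨d, rfl⟩ := I.exists_code hx
      exact (hp' I d).1 (h d)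
    have hn : 0 < I.size := by rw [size_eq]; have := I.pos; omega
    have key : ∀ m, (next I)^[m] 0 = min m (I.size - 1) := by
      intro m
      induction m with
      | zero => simp
      | succ m ih =>
        rw [iterate_succ_apply', ih]
        simp only [next]
        rw [hall _ (by omega)]
        split_ifs <;> omega
    simp only [test]
    rw [key, hall _ (by omega), if_pos (by norm_num), if_pos (by omega)]
  · obtain ⟨d, hd⟩ := not_forall.1 h
    have h0 := (hp' I d).2 hd
    have hstep : ∀ x ≤ I.code d, next I x ≤ I.code d := by
      intro x hx
      rcases hx.lt_or_eq with h' | rfl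
      · simp only [next]
        split_ifs <;> omega
      · simp [next, h0]
    have key : ∀ m, (next I)^[m] 0 ≤ I.code d := by
      intro m
      induction m with
      | zero => exact Nat.zero_le _
      | succ m ih =>
        rw [iterate_succ_apply']
        exact hstep _ ih
    have hk := key I.size
    have hlt := I.code_lt d
    simp only [test]
    split_ifs with h1 h2
    · exfalso
      apply h1
      rw [show (next I)^[I.size] 0 = I.code d by omega, h0]
    · rfl
    · rfl

end Combinators

/-! ### Computing the map and deciding colorability. -/

theorem dartComputable_rot : DartComputable fun I => I.R.rot := by
  have hq := Computable.divThree
  refine ⟨_, (((hq.add hq).add hq).add (.const 2)).eqTest .id |>.branch ((hq.add hq).add hq)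
    (Computable.id.add (.const 1)), fun I d => ?_⟩
  obtain ⟨i, hi⟩ := I.exists_dartAt d
  change _ = I.code (I.R.rot d)
  rw [← hi, rot_dartAt, code_dartAt, code_dartAt]
  have h3 : (3 * (d.fst : ℕ) + i) / 3 = d.fst := by omega
  have hsum : (d.fst : ℕ) + d.fst + d.fst = 3 * d.fst := by omega
  rw [h3, hsum]
  fin_cases i <;> simp

/-- The cell of a dart from v contains its head w. The reversed dart is the unique one among the
three cells of w that contains v, and v is the code divided by 3. -/
theorem dartComputable_flip : DartComputable fun I => dartFlip I.G := by
  have hw := Computable.load .id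
  have hb := (hw.add hw).add hw
  have ht := fun i : ℕ => (hb.add (.const i)).load.eqTest .divThree
  refine ⟨_, (ht 0).branch hb ((ht 1).branch (hb.add (.const 1)) (hb.add (.const 2))),
    fun I d => ?_⟩
  obtain ⟨i, hi⟩ := I.exists_dartAt (dartFlip I.G d)
  have hfst : (dartFlip I.G d).fst = d.snd := rfl
  rw [hfst] at hi
  have hm : ∀ j : Fin 3, I.memory (3 * d.snd + j) = d.fst ↔ j = i := by
    intro j
    rw [memory_eq]
    constructor
    · intro h
      apply I.dartAt_injective d.snd
      rw [hi]
      exact SimpleGraph.Dart.ext _ _ (Prod.ext rfl (Fin.ext h))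
    · rintro rfl
      exact congrArg (fun e : I.G.Dart => (e.snd : ℕ)) hi
  have hsum : (d.snd : ℕ) + d.snd + d.snd = 3 * d.snd := by omega
  simp only [memory_code, code_div, hsum]
  rw [← hi, code_dartAt]
  have h0 := hm 0
  have h1 := hm 1
  simp only [Fin.val_zero, Fin.val_one, add_zero] at h0 h1
  simp only [add_zero, h0, h1]
  fin_cases i <;> simp

theorem dartComputable_facePerm : DartComputable fun I => I.R.facePerm :=
  dartComputable_rot.comp dartComputable_flip

/-- Since face sizes lie between 3 and 6, for n = 3, 4, 5 the equation φⁿ d = d already determines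
the size. -/
theorem dartDecidable_period_three :
    DartDecidable fun I d => minimalPeriod I.R.facePerm d = 3 := by
  have h := dartComputable_facePerm
  refine (DartDecidable.eq (h.comp (h.comp h)) .id).congr fun I d => ⟨fun h3 => ?_, three_of_period⟩
  have h3' : IsPeriodicPt I.R.facePerm 3 d := h3
  have := Nat.le_of_dvd (by norm_num) h3'.minimalPeriod_dvd
  have := I.period d
  omega

theorem dartDecidable_period_four :
    DartDecidable fun I d => minimalPeriod I.R.facePerm d = 4 := by
  have h := dartComputable_facePerm
  refine (DartDecidable.eq (h.comp (h.comp (h.comp h))) .id).congr fun I d =>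
    ⟨fun h4 => ?_, four_of_period⟩
  have h4' : IsPeriodicPt I.R.facePerm 4 d := h4
  have h1 := h4'.minimalPeriod_dvd
  rcases I.period d with h | h | h | h <;> rw [h] at h1 ⊢ <;> revert h1 <;> decide

theorem dartDecidable_period_five :
    DartDecidable fun I d => minimalPeriod I.R.facePerm d = 5 := by
  have h := dartComputable_facePerm
  refine (DartDecidable.eq (h.comp (h.comp (h.comp (h.comp h)))) .id).congr fun I d =>
    ⟨fun h5 => ?_, fun h5 => ?_⟩
  · have h5' : IsPeriodicPt I.R.facePerm 5 d := h5
    have h1 := h5'.minimalPeriod_dvd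
    rcases I.period d with h | h | h | h <;> rw [h] at h1 ⊢ <;> revert h1 <;> decide
  · have := iterate_minimalPeriod (f := I.R.facePerm) (x := d)
    rwa [h5] at this

/-- By exclusion, since `φ⁶` is trivial on triangles as well. -/
theorem dartDecidable_period_six :
    DartDecidable fun I d => minimalPeriod I.R.facePerm d = 6 := by
  refine (dartDecidable_period_three.not.and (dartDecidable_period_four.not.and
    dartDecidable_period_five.not)).congr fun I d => ?_
  have := I.period d
  omega

theorem dartDecidable_meetsSquare :
    DartDecidable fun I d => MeetsSquare I.R.facePerm (dartFlip I.G) d := by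
  have h := dartComputable_facePerm
  have h1 : DartComputable fun I => followLine I.R.facePerm (dartFlip I.G) :=
    DartComputable.ite (dartDecidable_period_six.comp dartComputable_flip)
      ((h.comp (h.comp h)).comp dartComputable_flip) dartComputable_flip
  have h2 : DartComputable fun I => seekSquare I.R.facePerm (dartFlip I.G) :=
    DartComputable.ite dartDecidable_period_four .id h1
  -- The input has one cell per dart, so its length bounds the search.
  exact (dartDecidable_period_four.comp h2.iterate).congr fun I d =>
    (meetsSquare_iff I.card_dart.le d).symm

theorem solvableInPolynomialTime_distanceTwoColorable :
    SolvableInPolynomialTime BarnetteInstance.encode fun I => DistanceTwoColorable I.G 4 := by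
  have hM := dartDecidable_meetsSquare
  obtain ⟨f, hf, hf'⟩ := DartDecidable.forall (dartDecidable_period_five.not.and
    ((dartDecidable_period_three.imp hM.not).and (dartDecidable_period_six.imp
      (hM.and (hM.comp dartComputable_facePerm)).not)))
  have key : ∀ I : BarnetteInstance, DistanceTwoColorable I.G 4 ↔
      ∃ B, LineSystem I.R.facePerm (dartFlip I.G) B := fun I =>
    ⟨fun ⟨_, hc⟩ => ⟨_, lineSystem_of_coloring I.isCubic hc I.isTypeTwoBarnette.2.2⟩,
      fun ⟨_, hB⟩ => distanceTwoColorable_of_lineSystem I.isCubic I.isTypeTwoBarnette.1 hB⟩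
  have key' := fun I => (key I).trans (exists_lineSystem_iff dartFlip_dartFlip I.period)
  exact solvable_of_computable hf (fun I => by rw [size_eq]; have := I.pos; omega)
    (fun I hI => (hf' I).1 ((key' I).1 hI)) (fun I hI => (hf' I).2 (mt (key' I).2 hI))

end BarnetteColoring

theorem mainTheorem2 :
    (∀ (V : Type*) [Finite V] (G : SimpleGraph V) (R : BarnetteColoring.RotationSystem G),
      R.IsTypeTwoBarnette →
        (BarnetteColoring.DistanceTwoColorable G 4 ↔
          (∃ k : ℕ, Nonempty (G ≃g BarnetteColoring.goodeyGraph k)) ∨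
            ∀ f : R.Face, R.faceSize f = 3 ∨ R.faceSize f = 6)) ∧
    BarnetteColoring.SolvableInPolynomialTime BarnetteColoring.BarnetteInstance.encode
      (fun I => BarnetteColoring.DistanceTwoColorable I.G 4) := by
  exact ⟨fun V _ G R hR => BarnetteColoring.distanceTwoColorable_iff hR,
    BarnetteColoring.solvableInPolynomialTime_distanceTwoColorable⟩
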